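/- Let $x\mapsto s(t)A(t)x+d(t)$, $t\in I$, be a one-parameter equiform motion of $\mathbf{E}^7$ of class $C^1$, where $I$ is an open interval containing $0$, $s(t)>0$, $A(t)\in SO(7)$, $d(t)\in\mathbf{E}^7$, normalized by $A(0)=\mathrm{Id}$, $s(0)=1$, $d(0)=0$. Put $s'=\dot s(0)$, $\Omega=\dot A(0)$, $(b'_1,\dots,b'_7)=\dot d(0)$, and let $\omega_1,\dots,\omega_{21}$ be the entries of the skew-symmetric matrix $\Omega$ above the diagonal, numbered row by row. Let $$\mathbf{x}(\theta,\phi)=(\cos\theta\cos\phi,\ \sin\theta\cos\phi,\ \sin\phi,\ 0,0,0,0)^{T},\qquad \theta\in[0,2\pi],\ \phi\in[0,\pi],$$ and let $$\mathbf{X}(t,\theta,\phi)=\big[\mathrm{Id}+t(s'\,\mathrm{Id}+\Omega)\big]\mathbf{x}(\theta,\phi)+t\,\dot d(0)$$ be the kinematic 3-surface swept by the unit 2-sphere, up to first order in $t$. Assume the sphere conditions $$\sum_{i=2}^{6}\omega_i\omega_{i+5}=\omega_1\omega_7-\sum_{i=3}^{6}\omega_i\omega_{i+9}=\omega_1\omega_2+\sum_{i=8}^{11}\omega_i\omega_{i+4}=0,$$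 $$\sum_{i=2}^{6}\omega_i^2=\sum_{i=7}^{11}\omega_i^2,\qquad \omega_1^2+\sum_{i=3}^{6}\omega_i^2=\omega_7^2+\sum_{i=12}^{15}\omega_i^2,$$ and $b'_1=b'_2=b'_3=0$. Assume moreover that either $s'\neq0$, or both $\dot d(0)\ne 0$ and $(\omega_1,\dots,\omega_{15})\neq 0$ (this holds in particular whenever the two quantities $\beta=\sum_{i=1}^7 b_i'^2$ and $\delta=\frac14\big[2(s'^2+\omega_1^2)+\sum_{i=2}^{11}\omega_i^2\big]$ are both positive). Let $$\mathbf K=g^{ij}\big[\partial_l\Gamma_{ij}^l-\partial_j\Gamma_{il}^l+\Gamma_{ij}^l\Gamma_{lm}^m-\Gamma_{il}^m\Gamma_{jm}^l\big]$$ be the scalar curvature of the metric $g$ induced by $\mathbf{X}$ in the coordinates $(t,\theta,\phi)$. If, at $t=0$, $\mathbf K(0,\theta,\phi)$ has the same value $\mathbf K$ at all parameters $\theta\in[0,2\pi]$, $\phi\in[0,\pi]$ at which the first fundamental form is nondegenerate, then $|\mathbf{K}|<2$. -/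

import Mathlib

noncomputable section

/-- Euclidean 7-space. -/
abbrev E7 : Type := EuclideanSpace ℝ (Fin 7)

/-- A one-parameter equiform motion `x ↦ s(t) A(t) x + d(t)` of Euclidean 7-space, of class `C¹`,
defined for times `t` in an open interval `I` that contains `0`. -/
structure EquiformMotion where
  /-- the time interval -/
  I : Set ℝ
  isOpen_I : IsOpen I
  ordConnected_I : I.OrdConnected
  zero_mem_I : (0 : ℝ) ∈ I
  /-- the scaling factor -/
  s : ℝ → ℝ
  /-- the rotational part -/
  A : ℝ → Matrix (Fin 7) (Fin 7) ℝ
  /-- the translational part -/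
  d : ℝ → E7
  s_pos : ∀ t ∈ I, 0 < s t
  A_mem : ∀ t ∈ I, A t ∈ Matrix.specialOrthogonalGroup (Fin 7) ℝ
  contDiffOn_s : ContDiffOn ℝ 1 s I
  contDiffOn_A : ∀ i j, ContDiffOn ℝ 1 (fun t => A t i j) I
  contDiffOn_d : ContDiffOn ℝ 1 d I

namespace EquiformMotion

/-- The derivative `s'` of the scaling factor at time `0`. -/
def s' (m : EquiformMotion) : ℝ := deriv m.s 0

/-- The derivative `Ω` of the rotational part at time `0`, entry by entry. -/
def Ω (m : EquiformMotion) : Matrix (Fin 7) (Fin 7) ℝ :=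
  Matrix.of fun i j => deriv (fun t => m.A t i j) 0

/-- The derivative `d'` of the translational part at time `0`. -/
def d' (m : EquiformMotion) : E7 := deriv m.d 0

/-- The coordinates `b'₁, …, b'₇` of `d'` are `m.b' 0, …, m.b' 6`. -/
def b' (m : EquiformMotion) (i : Fin 7) : ℝ := m.d' i

/-- The entries `ω₁, …, ω₂₁` of `Ω` above the diagonal, numbered row by row. -/
def ω (m : EquiformMotion) : ℕ → ℝ
  | 1 => m.Ω 0 1
  | 2 => m.Ω 0 2
  | 3 => m.Ω 0 3
  | 4 => m.Ω 0 4
  | 5 => m.Ω 0 5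
  | 6 => m.Ω 0 6
  | 7 => m.Ω 1 2
  | 8 => m.Ω 1 3
  | 9 => m.Ω 1 4
  | 10 => m.Ω 1 5
  | 11 => m.Ω 1 6
  | 12 => m.Ω 2 3
  | 13 => m.Ω 2 4
  | 14 => m.Ω 2 5
  | 15 => m.Ω 2 6
  | 16 => m.Ω 3 4
  | 17 => m.Ω 3 5
  | 18 => m.Ω 3 6
  | 19 => m.Ω 4 5
  | 20 => m.Ω 4 6
  | 21 => m.Ω 5 6
  | _ => 0

/-- The frames of the moving and of the fixed space coincide at time `0`. -/
def NormalizedAtZero (m : EquiformMotion) : Prop :=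
  m.A 0 = 1 ∧ m.s 0 = 1 ∧ m.d 0 = 0

/-- The sphere conditions: the vectors `a₀(t), a₁(t), a₂(t)`, which are the first three columns of
`(1 + s' t) I + t Ω`, are pairwise orthogonal and have equal lengths. -/
def SphereConditions (m : EquiformMotion) : Prop :=
  (∑ i ∈ Finset.Icc 2 6, m.ω i * m.ω (i + 5) = 0) ∧
  (m.ω 1 * m.ω 7 - ∑ i ∈ Finset.Icc 3 6, m.ω i * m.ω (i + 9) = 0) ∧
  (m.ω 1 * m.ω 2 + ∑ i ∈ Finset.Icc 8 11, m.ω i * m.ω (i + 4) = 0) ∧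
  (∑ i ∈ Finset.Icc 2 6, m.ω i ^ 2 = ∑ i ∈ Finset.Icc 7 11, m.ω i ^ 2) ∧
  (m.ω 1 ^ 2 + ∑ i ∈ Finset.Icc 3 6, m.ω i ^ 2 = m.ω 7 ^ 2 + ∑ i ∈ Finset.Icc 12 15, m.ω i ^ 2)

end EquiformMotion

/-- The parametrized unit sphere in the space of the first three coordinates. -/
def sphereParam (θ φ : ℝ) : Fin 7 → ℝ :=
  ![Real.cos θ * Real.cos φ, Real.sin θ * Real.cos φ, Real.sin φ, 0, 0, 0, 0]

/-- The kinematic surface of the motion up to first order, in the parameters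
`u = (t, θ, φ)`:
`X(t,θ,φ) = [s(0) A(0) + t (s'(0) A(0) + s(0) A'(0))] x(θ,φ) + d(0) + t d'(0)`. -/
def EquiformMotion.firstOrderSurface (m : EquiformMotion) (u : Fin 3 → ℝ) : E7 :=
  WithLp.toLp 2
    ((m.s 0 • m.A 0 + u 0 • (m.s' • m.A 0 + m.s 0 • m.Ω)).mulVec (sphereParam (u 1) (u 2)))
    + m.d 0 + u 0 • m.d'

/-- The partial derivative of `F` in the `i`-th coordinate. -/
def partialDeriv {E : Type*} [NormedAddCommGroup E] [NormedSpace ℝ E]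
    (i : Fin 3) (F : (Fin 3 → ℝ) → E) (u : Fin 3 → ℝ) : E :=
  fderiv ℝ F u (Pi.single i 1)

/-- The first fundamental form `g_{ij} = ⟨∂X/∂u_i, ∂X/∂u_j⟩`. -/
def firstFundamentalForm (X : (Fin 3 → ℝ) → E7) (u : Fin 3 → ℝ) : Matrix (Fin 3) (Fin 3) ℝ :=
  Matrix.of fun i j => inner ℝ (partialDeriv i X u) (partialDeriv j X u)

/-- The Christoffel symbols of the second kind, `christoffel g l i j = Γ_{ij}^l`. -/
def christoffel (g : (Fin 3 → ℝ) → Matrix (Fin 3) (Fin 3) ℝ) (l i j : Fin 3)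
    (u : Fin 3 → ℝ) : ℝ :=
  (1 / 2) * ∑ k, (g u)⁻¹ l k *
    (partialDeriv j (fun v => g v i k) u + partialDeriv i (fun v => g v j k) u
      - partialDeriv k (fun v => g v i j) u)

/-- The scalar curvature of the metric `g`. -/
def scalarCurvature (g : (Fin 3 → ℝ) → Matrix (Fin 3) (Fin 3) ℝ) (u : Fin 3 → ℝ) : ℝ :=
  ∑ i, ∑ j, (g u)⁻¹ i j *
    ((∑ l, partialDeriv l (christoffel g l i j) u)
      - (∑ l, partialDeriv j (christoffel g l i l) u)
      + (∑ l, ∑ k, christoffel g l i j u * christoffel g k l k u)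
      - (∑ l, ∑ k, christoffel g k i l u * christoffel g l j k u))

end

/-!
Let `ξ ∈ ℝ³` be the angular velocity of the motion inside the space of the sphere
(`EquiformMotion.spin`), and let the components of `v ∈ ℝ³` be the inner products of the
translational velocity with the first three columns of `Ω` (`EquiformMotion.drift`). The sphere
conditions make the metric of the first-order surface equal to
`(D + 2 ⟨v, x⟩) dt² + 2 ⟨ξ × x + t v, dx⟩ dt + (1 + 2 s' t + μ t²) |dx|²`, with `|dx|²` the round
metric (`EquiformMotion.firstFundamentalForm_firstOrderSurface`).

Every time slice is a round, umbilic sphere, so the curvature is manageable. With `N²` the squared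
lapse at `t = 0`, the curvature tensor in the coordinates `(t, θ, φ)` is short
(`curvatureTensor_kinMetric`), and `(R - 2) N⁴` is a polynomial in `x`
(`scalarCurvature_kinMetric`). If `R` has a constant value `K` where the metric is nondegenerate,
this polynomial identity holds on the whole sphere, because both sides are real analytic in the
angles and `N²` does not vanish identically (`curvaturePoly_eq_zero_of_open`).

The identity splits into parts even and odd under `x ↦ -x`, each of which extends homogeneously to
`ℝ³` (`curvaturePoly_parts`). If `ξ ≠ 0`, comparing coefficients along the lines `ξ + β e` with
`e ⊥ ξ` forces `K - 2 = 4`, then `v = 0`, and then a relation between the velocities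
(`drift_eq_zero_of_spin_ne_zero`) which contradicts `3 w² ≥ 2 |ξ|²`, where `w` is the common length
of the first three columns of `Ω`. If `ξ = 0`, either `v ≠ 0` and `K = 3 / 2`, or `v = 0` and
`K - 2 = -(2 s'² + 4 w²) / (s'² + w² + |d'|²)` (`curvature_of_spin_eq_zero`), which lies strictly
between `-4` and `0`.
-/

noncomputable section

/-! ### Scalar curvature from a two-jet of the metric -/

/-- The linear form on coordinate space whose partial derivatives are the entries of `w`. -/
def ofPartials (w : Fin 3 → ℝ) : (Fin 3 → ℝ) →L[ℝ] ℝ :=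
  ∑ k, w k • ContinuousLinearMap.proj k

lemma ofPartials_single (w : Fin 3 → ℝ) (i : Fin 3) : ofPartials w (Pi.single i 1) = w i := by
  simp [ofPartials, Pi.single_apply]

/-- Computes the partial derivatives of `G` from any derivative of a function equal to it. -/
lemma hasFDerivAt_ofPartials {F G : (Fin 3 → ℝ) → ℝ} {L : (Fin 3 → ℝ) →L[ℝ] ℝ}
    {u w : Fin 3 → ℝ} (h : HasFDerivAt F L u) (hFG : ∀ v, G v = F v)
    (h₀ : L (Pi.single 0 1) = w 0) (h₁ : L (Pi.single 1 1) = w 1)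
    (h₂ : L (Pi.single 2 1) = w 2) : HasFDerivAt G (ofPartials w) u := by
  have hw : ∀ k, L (Pi.single k 1) = w k := fun k => by fin_cases k <;> assumption
  rw [funext hFG]
  refine h.congr_fderiv (ContinuousLinearMap.ext fun x => ?_)
  rw [← Finset.univ_sum_single x, map_sum, map_sum]
  refine Finset.sum_congr rfl fun k _ => ?_
  have : (Pi.single k (x k) : Fin 3 → ℝ) = x k • Pi.single k 1 := by
    rw [← Pi.single_smul', smul_eq_mul, mul_one]
  rw [this, map_smul, map_smul, hw, ofPartials_single]

lemma partialDeriv_eq_of_hasFDerivAt {F : (Fin 3 → ℝ) → ℝ} {w u : Fin 3 → ℝ}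
    (h : HasFDerivAt F (ofPartials w) u) (i : Fin 3) : partialDeriv i F u = w i := by
  rw [partialDeriv, h.fderiv, ofPartials_single]

lemma partialDeriv_mul {F G : (Fin 3 → ℝ) → ℝ} {u : Fin 3 → ℝ} (hF : DifferentiableAt ℝ F u)
    (hG : DifferentiableAt ℝ G u) (i : Fin 3) :
    partialDeriv i (fun v => F v * G v) u
      = F u * partialDeriv i G u + partialDeriv i F u * G u := by
  simp [partialDeriv, fderiv_fun_mul hF hG, mul_comm]

lemma differentiableAt_inv_apply {g : (Fin 3 → ℝ) → Matrix (Fin 3) (Fin 3) ℝ} {u : Fin 3 → ℝ}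
    (hg : ∀ i j, DifferentiableAt ℝ (fun v => g v i j) u) (hdet : (g u).det ≠ 0) (i j : Fin 3) :
    DifferentiableAt ℝ (fun v => (g v)⁻¹ i j) u := by
  have hD : DifferentiableAt ℝ (fun v => (g v).det) u := by
    simp only [Matrix.det_fin_three]
    fun_prop
  have hA : DifferentiableAt ℝ (fun v => (g v).adjugate i j) u := by
    simp only [Matrix.adjugate_fin_three]
    fin_cases i <;> fin_cases j <;> simp <;> fun_prop
  simp only [Matrix.inv_def, Ring.inverse_eq_inv', Matrix.smul_apply, smul_eq_mul]
  exact (hD.inv hdet).mul hA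

/-- The Christoffel symbols of the first kind, `loweredChristoffel dg k i j = Γ_{k,ij}`, of a metric
with derivatives `dg k = ∂_k g` at a point. Applied to `ddg m` it gives `∂_m Γ_{k,ij}`. -/
def loweredChristoffel (dg : Fin 3 → Matrix (Fin 3) (Fin 3) ℝ) (k i j : Fin 3) : ℝ :=
  (1 / 2) * (dg j i k + dg i j k - dg k i j)

lemma christoffel_eq {g : (Fin 3 → ℝ) → Matrix (Fin 3) (Fin 3) ℝ} {u : Fin 3 → ℝ}
    {dg : Fin 3 → Matrix (Fin 3) (Fin 3) ℝ}
    (hg : ∀ i j, HasFDerivAt (fun v => g v i j) (ofPartials fun k => dg k i j) u) (l i j : Fin 3) :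
    christoffel g l i j u = ∑ k, (g u)⁻¹ l k * loweredChristoffel dg k i j := by
  simp only [christoffel, partialDeriv_eq_of_hasFDerivAt (hg _ _), loweredChristoffel,
    Finset.mul_sum]
  exact Finset.sum_congr rfl fun k _ => by ring

/-- Differentiating `g Γ = Γ_lowered` gives the derivatives of the Christoffel symbols without
differentiating the inverse of the metric. -/
lemma partialDeriv_christoffel {g : (Fin 3 → ℝ) → Matrix (Fin 3) (Fin 3) ℝ}
    {dg : (Fin 3 → ℝ) → Fin 3 → Matrix (Fin 3) (Fin 3) ℝ} {u : Fin 3 → ℝ}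
    {ddg : Fin 3 → Fin 3 → Matrix (Fin 3) (Fin 3) ℝ}
    (hg : ∀ v i j, HasFDerivAt (fun v => g v i j) (ofPartials fun k => dg v k i j) v)
    (hdg : ∀ k i j, HasFDerivAt (fun v => dg v k i j) (ofPartials fun m => ddg m k i j) u)
    (hdet : (g u).det ≠ 0) (m l i j : Fin 3) :
    partialDeriv m (christoffel g l i j) u =
      ∑ k, (g u)⁻¹ l k * (loweredChristoffel (ddg m) k i j
        - ∑ n, dg u m k n * christoffel g n i j u) := by
  have hL : ∀ k, HasFDerivAt (fun v => loweredChristoffel (dg v) k i j)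
      (ofPartials fun m => loweredChristoffel (ddg m) k i j) u := by
    intro k
    have := (((hdg j i k).add (hdg i j k)).sub (hdg k i j)).const_mul (1 / 2)
    refine this.congr_fderiv ?_
    ext x
    simp [ofPartials, loweredChristoffel, Fin.sum_univ_three]
    ring
  have hΓ : ∀ n, DifferentiableAt ℝ (christoffel g n i j) u := by
    intro n
    have : christoffel g n i j
        = fun v => ∑ k, (g v)⁻¹ n k * loweredChristoffel (dg v) k i j :=
      funext fun v => christoffel_eq (hg v) n i j
    rw [this]
    refine DifferentiableAt.fun_sum fun k _ => ?_
    exact (differentiableAt_inv_apply (fun i j => (hg u i j).differentiableAt) hdet n k).mul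
      (hL k).differentiableAt
  have hnear : ∀ᶠ v in nhds u, (g v).det ≠ 0 := by
    have hD : ContinuousAt (fun v => (g v).det) u := by
      have h : ∀ i j, ContinuousAt (fun v => g v i j) u := fun i j => (hg u i j).continuousAt
      simp only [Matrix.det_fin_three]
      fun_prop
    exact hD.eventually_ne hdet
  -- Differentiate `∑ n, g k n * Γ^n_{ij} = L k i j`, then multiply by the inverse matrix.
  have hlow : ∀ k, (fun v => ∑ n, g v k n * christoffel g n i j v)
      =ᶠ[nhds u] fun v => loweredChristoffel (dg v) k i j := by
    intro k
    filter_upwards [hnear] with v hv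
    have hinv : g v * (g v)⁻¹ = 1 := Matrix.mul_nonsing_inv _ (isUnit_iff_ne_zero.mpr hv)
    have : ((g v) * (g v)⁻¹).mulVec (fun k => loweredChristoffel (dg v) k i j) k
        = loweredChristoffel (dg v) k i j := by rw [hinv, Matrix.one_mulVec]
    rw [← this, ← Matrix.mulVec_mulVec]
    simp only [Matrix.mulVec, dotProduct, christoffel_eq (hg v)]
  have hd : ∀ k, ∑ n, g u k n * partialDeriv m (christoffel g n i j) u
      = loweredChristoffel (ddg m) k i j - ∑ n, dg u m k n * christoffel g n i j u := by
    intro k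
    have h1 : partialDeriv m (fun v => ∑ n, g v k n * christoffel g n i j v) u
        = loweredChristoffel (ddg m) k i j := by
      rw [partialDeriv, (hlow k).fderiv_eq]
      exact partialDeriv_eq_of_hasFDerivAt (hL k) m
    have h2 : partialDeriv m (fun v => ∑ n, g v k n * christoffel g n i j v) u
        = ∑ n, (g u k n * partialDeriv m (christoffel g n i j) u
          + dg u m k n * christoffel g n i j u) := by
      rw [partialDeriv, fderiv_fun_sum fun n _ => ((hg u k n).differentiableAt.fun_mul (hΓ n)),
        _root_.sum_apply]
      refine Finset.sum_congr rfl fun n _ => ?_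
      have := partialDeriv_mul (hg u k n).differentiableAt (hΓ n) m
      rw [partialDeriv_eq_of_hasFDerivAt (hg u k n)] at this
      exact this
    rw [← h1, h2, Finset.sum_add_distrib]
    ring
  have hinv : (g u)⁻¹ * g u = 1 := Matrix.nonsing_inv_mul _ (isUnit_iff_ne_zero.mpr hdet)
  have : ((g u)⁻¹ * g u).mulVec (fun n => partialDeriv m (christoffel g n i j) u) l
      = partialDeriv m (christoffel g l i j) u := by rw [hinv, Matrix.one_mulVec]
  rw [← this, ← Matrix.mulVec_mulVec]
  simp only [Matrix.mulVec, dotProduct, hd]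

/-- The curvature tensor with all indices lowered, antisymmetric in `l, j` and in `p, i`, in terms
of the inverse `H` of the metric, its first derivatives `dg` and its second derivatives `ddg`. The
contraction of `l` with `p` is the Ricci tensor in the indices `i, j`. -/
def curvatureTensor (H : Matrix (Fin 3) (Fin 3) ℝ) (dg : Fin 3 → Matrix (Fin 3) (Fin 3) ℝ)
    (ddg : Fin 3 → Fin 3 → Matrix (Fin 3) (Fin 3) ℝ) (l p i j : Fin 3) : ℝ :=
  loweredChristoffel (ddg l) p i j - loweredChristoffel (ddg j) p i l
    - ∑ k, ∑ q, H k q * loweredChristoffel dg k p l * loweredChristoffel dg q i j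
    + ∑ k, ∑ q, H k q * loweredChristoffel dg k p j * loweredChristoffel dg q i l

/-- The scalar curvature is the double trace of the curvature tensor: the derivatives of the inverse
metric cancel one of the two quadratic terms of each kind. -/
theorem scalarCurvature_eq {g : (Fin 3 → ℝ) → Matrix (Fin 3) (Fin 3) ℝ}
    {dg : (Fin 3 → ℝ) → Fin 3 → Matrix (Fin 3) (Fin 3) ℝ} {u : Fin 3 → ℝ}
    {ddg : Fin 3 → Fin 3 → Matrix (Fin 3) (Fin 3) ℝ}
    (hg : ∀ v i j, HasFDerivAt (fun v => g v i j) (ofPartials fun k => dg v k i j) v)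
    (hdg : ∀ k i j, HasFDerivAt (fun v => dg v k i j) (ofPartials fun m => ddg m k i j) u)
    (hdet : (g u).det ≠ 0) (hsymm : ∀ k, (dg u k).IsSymm) (hgs : (g u).IsSymm) :
    scalarCurvature g u = ∑ i, ∑ j, ∑ l, ∑ p, (g u)⁻¹ i j * (g u)⁻¹ l p *
      curvatureTensor (g u)⁻¹ (dg u) ddg l p i j := by
  unfold scalarCurvature
  refine Finset.sum_congr rfl fun i _ => Finset.sum_congr rfl fun j _ => ?_
  simp only [partialDeriv_christoffel hg hdg hdet]
  have hH : ∀ a b, (g u)⁻¹ a b = (g u)⁻¹ b a := fun a b => hgs.inv.apply b a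
  have hsplit : ∀ m k n, dg u m k n
      = loweredChristoffel (dg u) k n m + loweredChristoffel (dg u) n k m := by
    intro m k n
    have h1 := (hsymm m).apply k n
    have h2 := (hsymm k).apply n m
    have h3 := (hsymm n).apply k m
    simp only [loweredChristoffel]
    linarith
  have hLs : ∀ k a b, loweredChristoffel (dg u) k a b = loweredChristoffel (dg u) k b a := by
    intro k a b
    have h1 := (hsymm k).apply a b
    simp only [loweredChristoffel]
    linarith
  have hrw : ∀ l p, (g u)⁻¹ i j * (g u)⁻¹ l p * curvatureTensor (g u)⁻¹ (dg u) ddg l p i j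
      = (g u)⁻¹ i j * ((g u)⁻¹ l p * curvatureTensor (g u)⁻¹ (dg u) ddg l p i j) :=
    fun l p => mul_assoc _ _ _
  simp only [hrw, ← Finset.mul_sum]
  congr 1
  simp only [hsplit, christoffel_eq (hg u), curvatureTensor, Fin.sum_univ_three,
    hH 1 0, hH 2 0, hH 2 1, hLs _ 1 0, hLs _ 2 0, hLs _ 2 1, hLs _ j 0, hLs _ j 1, hLs _ j 2]
  ring

/-- In dimension three the double trace of a curvature-like tensor has only nine essential terms,
weighted by minors of the inverse metric. -/
lemma sum_mul_mul_of_antisymm {H : Matrix (Fin 3) (Fin 3) ℝ}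
    {R : Fin 3 → Fin 3 → Fin 3 → Fin 3 → ℝ} (hH : H.IsSymm)
    (h₁ : ∀ l p i j, R j p i l = -R l p i j) (h₂ : ∀ l p i j, R l i p j = -R l p i j) :
    ∑ i, ∑ j, ∑ l, ∑ p, H i j * H l p * R l p i j =
      2 * ((H 1 1 * H 0 0 - H 0 1 * H 0 1) * R 0 0 1 1
        + (H 1 2 * H 0 0 - H 0 2 * H 0 1) * (R 0 0 2 1 + R 0 0 1 2)
        + (H 1 2 * H 0 1 - H 0 2 * H 1 1) * (R 0 1 2 1 + R 1 0 1 2)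
        + (H 2 2 * H 0 0 - H 0 2 * H 0 2) * R 0 0 2 2
        + (H 2 2 * H 0 1 - H 0 2 * H 1 2) * (R 0 1 2 2 + R 1 0 2 2)
        + (H 2 2 * H 1 1 - H 1 2 * H 1 2) * R 1 1 2 2) := by
  have z₁ : ∀ l p i, R l p i l = 0 := fun l p i => by linarith [h₁ l p i l]
  have z₂ : ∀ l p j, R l p p j = 0 := fun l p j => by linarith [h₂ l p p j]
  have e10 : ∀ p i, R 1 p i 0 = -R 0 p i 1 := fun p i => h₁ 0 p i 1
  have e20 : ∀ p i, R 2 p i 0 = -R 0 p i 2 := fun p i => h₁ 0 p i 2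
  have e21 : ∀ p i, R 2 p i 1 = -R 1 p i 2 := fun p i => h₁ 1 p i 2
  have f10 : ∀ l j, R l 1 0 j = -R l 0 1 j := fun l j => h₂ l 0 1 j
  have f20 : ∀ l j, R l 2 0 j = -R l 0 2 j := fun l j => h₂ l 0 2 j
  have f21 : ∀ l j, R l 2 1 j = -R l 1 2 j := fun l j => h₂ l 1 2 j
  have hs : ∀ a b, H a b = H b a := fun a b => hH.apply b a
  simp only [Fin.sum_univ_three, z₁, z₂, e10, e20, e21, f10, f20, f21, hs 1 0, hs 2 0, hs 2 1]
  ring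

lemma curvatureTensor_swap_left (H : Matrix (Fin 3) (Fin 3) ℝ)
    (dg : Fin 3 → Matrix (Fin 3) (Fin 3) ℝ) (ddg : Fin 3 → Fin 3 → Matrix (Fin 3) (Fin 3) ℝ)
    (l p i j : Fin 3) :
    curvatureTensor H dg ddg j p i l = -curvatureTensor H dg ddg l p i j := by
  simp only [curvatureTensor]
  ring

lemma curvatureTensor_swap_right {H : Matrix (Fin 3) (Fin 3) ℝ}
    {dg : Fin 3 → Matrix (Fin 3) (Fin 3) ℝ} {ddg : Fin 3 → Fin 3 → Matrix (Fin 3) (Fin 3) ℝ}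
    (hH : H.IsSymm) (hdd : ∀ m k, ddg m k = ddg k m)
    (hdds : ∀ m k, (ddg m k).IsSymm) (l p i j : Fin 3) :
    curvatureTensor H dg ddg l i p j = -curvatureTensor H dg ddg l p i j := by
  have hs : ∀ m k a b, ddg m k a b = ddg m k b a := fun m k a b => (hdds m k).apply b a
  have hq : ∀ a b c d, ∑ k, ∑ q, H k q * loweredChristoffel dg k a b * loweredChristoffel dg q c d
      = ∑ k, ∑ q, H k q * loweredChristoffel dg k c d * loweredChristoffel dg q a b := by
    intro a b c d
    rw [Finset.sum_comm]
    refine Finset.sum_congr rfl fun k _ => Finset.sum_congr rfl fun q _ => ?_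
    rw [hH.apply k q]
    ring
  have key : loweredChristoffel (ddg l) i p j - loweredChristoffel (ddg j) i p l
      = -(loweredChristoffel (ddg l) p i j - loweredChristoffel (ddg j) p i l) := by
    simp only [loweredChristoffel, hdd j l]
    linarith [hs l j i p, hs l i j p, hs l p i j, hs l j p i, hs j i l p, hs j p i l]
  simp only [curvatureTensor]
  rw [hq p l i j, hq p j i l]
  linear_combination key

/-! ### The metric of a kinematic surface and its derivatives -/

/-- The radial component `⟨a, x⟩` of `a ∈ ℝ³` at the point `x` of the unit sphere with longitude
`u 1` and latitude `u 2`. -/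
def radial (a : Fin 3 → ℝ) (u : Fin 3 → ℝ) : ℝ :=
  a 0 * (Real.cos (u 1) * Real.cos (u 2)) + a 1 * (Real.sin (u 1) * Real.cos (u 2))
    + a 2 * Real.sin (u 2)

/-- The component of `a ∈ ℝ³` along the unit tangent vector in the direction of `∂x/∂θ`. -/
def eastward (a : Fin 3 → ℝ) (u : Fin 3 → ℝ) : ℝ :=
  -(a 0 * Real.sin (u 1)) + a 1 * Real.cos (u 1)

/-- The component of `a ∈ ℝ³` along the unit tangent vector `∂x/∂φ`. -/
def northward (a : Fin 3 → ℝ) (u : Fin 3 → ℝ) : ℝ :=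
  -(a 0 * (Real.cos (u 1) * Real.sin (u 2))) - a 1 * (Real.sin (u 1) * Real.sin (u 2))
    + a 2 * Real.cos (u 2)

/-- The metric `(D + 2 ⟨v, x⟩) dt² + 2 ⟨ξ × x + t v, dx⟩ dt + (1 + 2 σ t + μ t²) |dx|²` on the
product of a line with the unit sphere, in the coordinates `u = (t, θ, φ)`. -/
def kinMetric (D σ μ : ℝ) (ξ v u : Fin 3 → ℝ) : Matrix (Fin 3) (Fin 3) ℝ :=
  let c := Real.cos (u 2)
  !![D + 2 * radial v u, c * northward ξ u + u 0 * (c * eastward v u),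
      -eastward ξ u + u 0 * northward v u;
    c * northward ξ u + u 0 * (c * eastward v u), (1 + 2 * σ * u 0 + μ * (u 0 * u 0)) * (c * c), 0;
    -eastward ξ u + u 0 * northward v u, 0, 1 + 2 * σ * u 0 + μ * (u 0 * u 0)]

/-- The derivative of `kinMetric` in the `k`-th coordinate. -/
def kinMetricDeriv (σ μ : ℝ) (ξ v u : Fin 3 → ℝ) (k : Fin 3) : Matrix (Fin 3) (Fin 3) ℝ :=
  let t := u 0
  let c := Real.cos (u 2)
  let s := Real.sin (u 2)
  let f := radial v u
  let F := eastward v u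
  let W := northward v u
  let p := radial ξ u
  let q := eastward ξ u
  let r := northward ξ u
  match k with
  | 0 => !![0, c * F, W; c * F, (2 * σ + 2 * μ * t) * (c * c), 0; W, 0, 2 * σ + 2 * μ * t]
  | 1 => !![2 * (c * F), -(c * (s * q)) - t * (c * (c * f - s * W)), c * p - s * r - t * (s * F);
      -(c * (s * q)) - t * (c * (c * f - s * W)), 0, 0;
      c * p - s * r - t * (s * F), 0, 0]
  | 2 => !![2 * W, -(s * r) - c * p - t * (s * F), -(t * f);
      -(s * r) - c * p - t * (s * F), -2 * (1 + 2 * σ * t + μ * (t * t)) * (c * s), 0;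
      -(t * f), 0, 0]

/-- The second derivatives of `kinMetric` at a point with time coordinate zero. -/
def kinMetricDerivTwo (σ μ : ℝ) (ξ v u : Fin 3 → ℝ) (m k : Fin 3) :
    Matrix (Fin 3) (Fin 3) ℝ :=
  let c := Real.cos (u 2)
  let s := Real.sin (u 2)
  let f := radial v u
  let F := eastward v u
  let W := northward v u
  let p := radial ξ u
  let q := eastward ξ u
  let r := northward ξ u
  let d₀₁ := !![0, -(c * (c * f - s * W)), -(s * F); -(c * (c * f - s * W)), 0, 0; -(s * F), 0, 0]
  let d₀₂ := !![0, -(s * F), -f; -(s * F), -4 * σ * (c * s), 0; -f, 0, 0]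
  let d₁₂ := !![-2 * (s * F), (s * s - c * c) * q, 0; (s * s - c * c) * q, 0, 0; 0, 0, 0]
  match m, k with
  | 0, 0 => !![0, 0, 0; 0, 2 * μ * (c * c), 0; 0, 0, 2 * μ]
  | 0, 1 => d₀₁
  | 0, 2 => d₀₂
  | 1, 0 => d₀₁
  | 1, 1 => !![-2 * (c * (c * f - s * W)), c * (s * (c * p - s * r)), (c * c + s * s) * q;
      c * (s * (c * p - s * r)), 0, 0; (c * c + s * s) * q, 0, 0]
  | 1, 2 => d₁₂
  | 2, 0 => d₀₂
  | 2, 1 => d₁₂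
  | 2, 2 => !![-2 * f, 2 * (s * p - c * r), 0;
      2 * (s * p - c * r), -2 * (c * c - s * s), 0; 0, 0, 0]

section derivatives

variable (a u : Fin 3 → ℝ)

lemma hasFDerivAt_coord (i : Fin 3) :
    HasFDerivAt (fun w : Fin 3 → ℝ => w i) (ofPartials (Pi.single i 1)) u := by
  refine (hasFDerivAt_apply i u).congr_fderiv ?_
  ext x
  simp [ofPartials, Pi.single_apply]

lemma hasFDerivAt_cos_latitude :
    HasFDerivAt (fun w : Fin 3 → ℝ => Real.cos (w 2)) (ofPartials ![0, 0, -Real.sin (u 2)]) u := by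
  refine (hasFDerivAt_coord u 2).cos.congr_fderiv ?_
  ext x
  simp [ofPartials, Fin.sum_univ_three, Pi.single_apply]

lemma hasFDerivAt_sin_latitude :
    HasFDerivAt (fun w : Fin 3 → ℝ => Real.sin (w 2)) (ofPartials ![0, 0, Real.cos (u 2)]) u := by
  refine (hasFDerivAt_coord u 2).sin.congr_fderiv ?_
  ext x
  simp [ofPartials, Fin.sum_univ_three, Pi.single_apply]

lemma hasFDerivAt_radial :
    HasFDerivAt (radial a)
      (ofPartials ![0, Real.cos (u 2) * eastward a u, northward a u]) u := by
  have hC := (hasFDerivAt_coord u 1).cos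
  have hS := (hasFDerivAt_coord u 1).sin
  have hc := hasFDerivAt_cos_latitude u
  have hs := hasFDerivAt_sin_latitude u
  refine ((((hC.fun_mul hc).const_mul (a 0)).fun_add ((hS.fun_mul hc).const_mul (a 1))).fun_add
    (hs.const_mul (a 2))).congr_fderiv ?_
  ext x
  simp [ofPartials, Fin.sum_univ_three, Pi.single_apply, eastward, northward]
  ring

lemma hasFDerivAt_eastward :
    HasFDerivAt (eastward a) (ofPartials ![0,
      -(Real.cos (u 2) * radial a u - Real.sin (u 2) * northward a u), 0]) u := by
  have hC := (hasFDerivAt_coord u 1).cos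
  have hS := (hasFDerivAt_coord u 1).sin
  refine ((hS.const_mul (a 0)).fun_neg.fun_add (hC.const_mul (a 1))).congr_fderiv ?_
  ext x
  simp [ofPartials, Fin.sum_univ_three, Pi.single_apply, radial, northward]
  linear_combination ((Real.cos (u 1) * a 0 + Real.sin (u 1) * a 1) * x 1) *
    Real.sin_sq_add_cos_sq (u 2)

lemma hasFDerivAt_northward :
    HasFDerivAt (northward a)
      (ofPartials ![0, -(Real.sin (u 2) * eastward a u), -radial a u]) u := by
  have hC := (hasFDerivAt_coord u 1).cos
  have hS := (hasFDerivAt_coord u 1).sin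
  have hc := hasFDerivAt_cos_latitude u
  have hs := hasFDerivAt_sin_latitude u
  refine ((((hC.fun_mul hs).const_mul (a 0)).fun_neg.fun_sub
    ((hS.fun_mul hs).const_mul (a 1))).fun_add (hc.const_mul (a 2))).congr_fderiv ?_
  ext x
  simp [ofPartials, Fin.sum_univ_three, Pi.single_apply, eastward, radial]
  ring

end derivatives

section metric

variable (D σ μ : ℝ) (ξ v u : Fin 3 → ℝ)

lemma hasFDerivAt_kinMetric (i j : Fin 3) :
    HasFDerivAt (fun w => kinMetric D σ μ ξ v w i j)
      (ofPartials fun k => kinMetricDeriv σ μ ξ v u k i j) u := by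
  have ht := hasFDerivAt_coord u 0
  have hc := hasFDerivAt_cos_latitude u
  have hf := hasFDerivAt_radial v u
  have hF := hasFDerivAt_eastward v u
  have hW := hasFDerivAt_northward v u
  have hq := hasFDerivAt_eastward ξ u
  have hr := hasFDerivAt_northward ξ u
  have hl := ((ht.const_mul (2 * σ)).const_add 1).fun_add ((ht.fun_mul ht).const_mul μ)
  have h00 := (hf.const_mul 2).const_add D
  have h01 := (hc.fun_mul hr).fun_add (ht.fun_mul (hc.fun_mul hF))
  have h02 := hq.fun_neg.fun_add (ht.fun_mul hW)
  have h11 := hl.fun_mul (hc.fun_mul hc)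
  have hz : HasFDerivAt (fun _ : Fin 3 → ℝ => (0 : ℝ)) (0 : (Fin 3 → ℝ) →L[ℝ] ℝ) u :=
    hasFDerivAt_const 0 u
  match i, j with
  | 0, 0 =>
    exact hasFDerivAt_ofPartials h00 (fun w => by simp [kinMetric])
      (by simp [kinMetricDeriv, ofPartials_single]; try ring)
      (by simp [kinMetricDeriv, ofPartials_single]; try ring)
      (by simp [kinMetricDeriv, ofPartials_single]; try ring)
  | 0, 1 | 1, 0 =>
    exact hasFDerivAt_ofPartials h01 (fun w => by simp [kinMetric])
      (by simp [kinMetricDeriv, ofPartials_single]; try ring)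
      (by simp [kinMetricDeriv, ofPartials_single]; try ring)
      (by simp [kinMetricDeriv, ofPartials_single]; try ring)
  | 0, 2 | 2, 0 =>
    exact hasFDerivAt_ofPartials h02 (fun w => by simp [kinMetric])
      (by simp [kinMetricDeriv, ofPartials_single]; try ring)
      (by simp [kinMetricDeriv, ofPartials_single]; try ring)
      (by simp [kinMetricDeriv, ofPartials_single]; try ring)
  | 1, 1 =>
    exact hasFDerivAt_ofPartials h11 (fun w => by simp [kinMetric])
      (by simp [kinMetricDeriv, ofPartials_single]; try ring)
      (by simp [kinMetricDeriv, ofPartials_single]; try ring)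
      (by simp [kinMetricDeriv, ofPartials_single]; try ring)
  | 2, 2 =>
    exact hasFDerivAt_ofPartials hl (fun w => by simp [kinMetric])
      (by simp [kinMetricDeriv, ofPartials_single]; try ring)
      (by simp [kinMetricDeriv, ofPartials_single]; try ring)
      (by simp [kinMetricDeriv, ofPartials_single]; try ring)
  | 1, 2 | 2, 1 =>
    exact hasFDerivAt_ofPartials hz (fun w => by simp [kinMetric])
      (by simp [kinMetricDeriv]) (by simp [kinMetricDeriv]) (by simp [kinMetricDeriv])

lemma hasFDerivAt_kinMetricDeriv (hu : u 0 = 0) (k i j : Fin 3) :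
    HasFDerivAt (fun w => kinMetricDeriv σ μ ξ v w k i j)
      (ofPartials fun m => kinMetricDerivTwo σ μ ξ v u m k i j) u := by
  have ht := hasFDerivAt_coord u 0
  have hc := hasFDerivAt_cos_latitude u
  have hs := hasFDerivAt_sin_latitude u
  have hf := hasFDerivAt_radial v u
  have hF := hasFDerivAt_eastward v u
  have hW := hasFDerivAt_northward v u
  have hp := hasFDerivAt_radial ξ u
  have hq := hasFDerivAt_eastward ξ u
  have hr := hasFDerivAt_northward ξ u
  have hl := ((ht.const_mul (2 * σ)).const_add 1).fun_add ((ht.fun_mul ht).const_mul μ)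
  have hl' := (ht.const_mul (2 * μ)).const_add (2 * σ)
  have h001 := hc.fun_mul hF
  have h011 := hl'.fun_mul (hc.fun_mul hc)
  have h100 := h001.const_mul 2
  have h101 := (hc.fun_mul (hs.fun_mul hq)).fun_neg.fun_sub
    (ht.fun_mul (hc.fun_mul ((hc.fun_mul hf).fun_sub (hs.fun_mul hW))))
  have h102 := ((hc.fun_mul hp).fun_sub (hs.fun_mul hr)).fun_sub (ht.fun_mul (hs.fun_mul hF))
  have h200 := hW.const_mul 2
  have h201 := ((hs.fun_mul hr).fun_neg.fun_sub (hc.fun_mul hp)).fun_sub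
    (ht.fun_mul (hs.fun_mul hF))
  have h202 := (ht.fun_mul hf).fun_neg
  have h211 := (hl.const_mul (-2)).fun_mul (hc.fun_mul hs)
  have hz : HasFDerivAt (fun _ : Fin 3 → ℝ => (0 : ℝ)) (0 : (Fin 3 → ℝ) →L[ℝ] ℝ) u :=
    hasFDerivAt_const 0 u
  match k, i, j with
  | 0, 0, 1 | 0, 1, 0 =>
    exact hasFDerivAt_ofPartials h001 (fun w => by simp [kinMetricDeriv])
      (by simp [kinMetricDerivTwo, ofPartials_single]; try ring)
      (by simp [kinMetricDerivTwo, ofPartials_single]; try ring)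
      (by simp [kinMetricDerivTwo, ofPartials_single]; try ring)
  | 0, 0, 2 | 0, 2, 0 =>
    exact hasFDerivAt_ofPartials hW (fun w => by simp [kinMetricDeriv])
      (by simp [kinMetricDerivTwo, ofPartials_single]; try ring)
      (by simp [kinMetricDerivTwo, ofPartials_single]; try ring)
      (by simp [kinMetricDerivTwo, ofPartials_single]; try ring)
  | 0, 1, 1 =>
    exact hasFDerivAt_ofPartials h011 (fun w => by simp [kinMetricDeriv])
      (by simp [kinMetricDerivTwo, ofPartials_single, hu]; try ring)
      (by simp [kinMetricDerivTwo, ofPartials_single, hu]; try ring)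
      (by simp [kinMetricDerivTwo, ofPartials_single, hu]; try ring)
  | 0, 2, 2 =>
    exact hasFDerivAt_ofPartials hl' (fun w => by simp [kinMetricDeriv])
      (by simp [kinMetricDerivTwo, ofPartials_single]; try ring)
      (by simp [kinMetricDerivTwo, ofPartials_single]; try ring)
      (by simp [kinMetricDerivTwo, ofPartials_single]; try ring)
  | 1, 0, 0 =>
    exact hasFDerivAt_ofPartials h100 (fun w => by simp [kinMetricDeriv])
      (by simp [kinMetricDerivTwo, ofPartials_single]; try ring)
      (by simp [kinMetricDerivTwo, ofPartials_single]; try ring)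
      (by simp [kinMetricDerivTwo, ofPartials_single]; try ring)
  | 1, 0, 1 | 1, 1, 0 =>
    exact hasFDerivAt_ofPartials h101 (fun w => by simp [kinMetricDeriv])
      (by simp [kinMetricDerivTwo, ofPartials_single, hu]; try ring)
      (by simp [kinMetricDerivTwo, ofPartials_single, hu]; try ring)
      (by simp [kinMetricDerivTwo, ofPartials_single, hu]; try ring)
  | 1, 0, 2 | 1, 2, 0 =>
    exact hasFDerivAt_ofPartials h102 (fun w => by simp [kinMetricDeriv])
      (by simp [kinMetricDerivTwo, ofPartials_single, hu]; try ring)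
      (by simp [kinMetricDerivTwo, ofPartials_single, hu]; try ring)
      (by simp [kinMetricDerivTwo, ofPartials_single, hu]; try ring)
  | 2, 0, 0 =>
    exact hasFDerivAt_ofPartials h200 (fun w => by simp [kinMetricDeriv])
      (by simp [kinMetricDerivTwo, ofPartials_single]; try ring)
      (by simp [kinMetricDerivTwo, ofPartials_single]; try ring)
      (by simp [kinMetricDerivTwo, ofPartials_single]; try ring)
  | 2, 0, 1 | 2, 1, 0 =>
    exact hasFDerivAt_ofPartials h201 (fun w => by simp [kinMetricDeriv])
      (by simp [kinMetricDerivTwo, ofPartials_single, hu]; try ring)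
      (by simp [kinMetricDerivTwo, ofPartials_single, hu]; try ring)
      (by simp [kinMetricDerivTwo, ofPartials_single, hu]; try ring)
  | 2, 0, 2 | 2, 2, 0 =>
    exact hasFDerivAt_ofPartials h202 (fun w => by simp [kinMetricDeriv])
      (by simp [kinMetricDerivTwo, ofPartials_single, hu]; try ring)
      (by simp [kinMetricDerivTwo, ofPartials_single, hu]; try ring)
      (by simp [kinMetricDerivTwo, ofPartials_single, hu]; try ring)
  | 2, 1, 1 =>
    exact hasFDerivAt_ofPartials h211 (fun w => by simp [kinMetricDeriv])
      (by simp [kinMetricDerivTwo, ofPartials_single, hu]; try ring)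
      (by simp [kinMetricDerivTwo, ofPartials_single, hu]; try ring)
      (by simp [kinMetricDerivTwo, ofPartials_single, hu]; try ring)
  | 0, 0, 0 | 0, 1, 2 | 0, 2, 1 | 1, 1, 1 | 1, 1, 2 | 1, 2, 1 | 1, 2, 2 | 2, 1, 2 | 2, 2, 1 |
      2, 2, 2 =>
    exact hasFDerivAt_ofPartials hz (fun w => by simp [kinMetricDeriv])
      (by simp [kinMetricDerivTwo]) (by simp [kinMetricDerivTwo]) (by simp [kinMetricDerivTwo])

end metric

/-! ### Scalar curvature of the kinematic metric at time zero -/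

/-- The square of the lapse of `kinMetric` at time zero: the squared distance of `∂_t` from the
tangent plane of the sphere. -/
def lapseSq (D : ℝ) (ξ v u : Fin 3 → ℝ) : ℝ :=
  D + 2 * radial v u - eastward ξ u ^ 2 - northward ξ u ^ 2

section value

variable {D σ μ : ℝ} {ξ v u : Fin 3 → ℝ}

lemma kinMetric_isSymm : (kinMetric D σ μ ξ v u).IsSymm := by
  ext i j
  fin_cases i <;> fin_cases j <;> simp [kinMetric]

lemma kinMetricDeriv_isSymm (k : Fin 3) : (kinMetricDeriv σ μ ξ v u k).IsSymm := by
  refine Matrix.IsSymm.ext fun i j => ?_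
  match k with
  | 0 | 1 | 2 => fin_cases i <;> fin_cases j <;> simp [kinMetricDeriv]

lemma kinMetricDerivTwo_comm (m k : Fin 3) :
    kinMetricDerivTwo σ μ ξ v u m k = kinMetricDerivTwo σ μ ξ v u k m := by
  match m, k with
  | 0, 0 | 0, 1 | 0, 2 | 1, 0 | 1, 1 | 1, 2 | 2, 0 | 2, 1 | 2, 2 => rfl

lemma kinMetricDerivTwo_isSymm (m k : Fin 3) : (kinMetricDerivTwo σ μ ξ v u m k).IsSymm := by
  refine Matrix.IsSymm.ext fun i j => ?_
  match m, k with
  | 0, 0 | 0, 1 | 0, 2 | 1, 0 | 1, 1 | 1, 2 | 2, 0 | 2, 1 | 2, 2 =>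
    fin_cases i <;> fin_cases j <;> simp [kinMetricDerivTwo]

lemma det_kinMetric (hu : u 0 = 0) :
    (kinMetric D σ μ ξ v u).det = lapseSq D ξ v u * Real.cos (u 2) ^ 2 := by
  simp [kinMetric, Matrix.det_fin_three, hu, lapseSq]
  ring

/-- The inverse of `kinMetric` at time zero. -/
def kinMetricInv (D : ℝ) (ξ v u : Fin 3 → ℝ) : Matrix (Fin 3) (Fin 3) ℝ :=
  let k := (Real.cos (u 2))⁻¹
  let h := (lapseSq D ξ v u)⁻¹
  let q := eastward ξ u
  let r := northward ξ u
  !![h, -(r * k * h), q * h;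
    -(r * k * h), k ^ 2 + r ^ 2 * k ^ 2 * h, -(r * q * k * h);
    q * h, -(r * q * k * h), 1 + q ^ 2 * h]

lemma inv_kinMetric (hu : u 0 = 0) (hQ : lapseSq D ξ v u ≠ 0) (hc : Real.cos (u 2) ≠ 0) :
    (kinMetric D σ μ ξ v u)⁻¹ =
      kinMetricInv D ξ v u := by
  refine Matrix.inv_eq_right_inv ?_
  have hE : D + 2 * radial v u = lapseSq D ξ v u + eastward ξ u ^ 2 + northward ξ u ^ 2 := by
    simp only [lapseSq]; ring
  simp only [kinMetric, kinMetricInv, hu, hE]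
  generalize lapseSq D ξ v u = Q at *
  generalize eastward ξ u = q
  generalize northward ξ u = r
  generalize Real.cos (u 2) = c at *
  ext i j
  fin_cases i <;> fin_cases j <;>
    simp [Matrix.mul_apply, Fin.sum_univ_three] <;> field_simp <;> ring

/-- The essential components of the curvature tensor of `kinMetric` at time zero. The factors `α`
and `γ` are the components of half the derivative of the squared lapse, shifted by the expansion rate
`σ` times the vector `ξ × x`, up to sign. -/
lemma curvatureTensor_kinMetric (hu : u 0 = 0) (hc : Real.cos (u 2) ≠ 0) :
    let R := curvatureTensor (kinMetricInv D ξ v u) (kinMetricDeriv σ μ ξ v u)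
      (kinMetricDerivTwo σ μ ξ v u)
    let c := Real.cos (u 2)
    let h := (lapseSq D ξ v u)⁻¹
    let α := eastward v u + radial ξ u * eastward ξ u - σ * northward ξ u
    let γ := northward v u + radial ξ u * northward ξ u + σ * eastward ξ u
    R 0 0 1 1 = c ^ 2 * (σ ^ 2 - μ + radial ξ u ^ 2 + h * α ^ 2) ∧
    R 0 0 2 1 = c * h * α * γ ∧
    R 0 0 1 2 = c * h * α * γ ∧
    R 0 1 2 1 = c ^ 2 * (eastward ξ u - σ * h * γ) ∧
    R 1 0 1 2 = c ^ 2 * (eastward ξ u - σ * h * γ) ∧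
    R 0 0 2 2 = σ ^ 2 - μ + radial ξ u ^ 2 + h * γ ^ 2 ∧
    R 0 1 2 2 = c * (northward ξ u + σ * h * α) ∧
    R 1 0 2 2 = c * (northward ξ u + σ * h * α) ∧
    R 1 1 2 2 = c ^ 2 * (1 - σ ^ 2 * h) := by
  have hcs := Real.sin_sq_add_cos_sq (u 2)
  simp only [curvatureTensor, loweredChristoffel, kinMetricDeriv, kinMetricDerivTwo, kinMetricInv,
    Fin.sum_univ_three, hu]
  generalize (lapseSq D ξ v u)⁻¹ = h
  generalize eastward v u = F
  generalize northward v u = W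
  generalize radial v u = f
  generalize eastward ξ u = q
  generalize northward ξ u = r
  generalize radial ξ u = p
  generalize Real.cos (u 2) = c at *
  generalize Real.sin (u 2) = s at *
  refine ⟨?_, ?_, ?_, ?_, ?_, ?_, ?_, ?_, ?_⟩ <;> simp <;> field_simp <;> grind

theorem scalarCurvature_kinMetric (hu : u 0 = 0) (hQ : lapseSq D ξ v u ≠ 0)
    (hc : Real.cos (u 2) ≠ 0) :
    (scalarCurvature (kinMetric D σ μ ξ v) u - 2) * lapseSq D ξ v u ^ 2 =
      lapseSq D ξ v u * (2 * σ ^ 2 - 4 * μ + 4 * radial ξ u ^ 2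
        - 2 * (eastward ξ u ^ 2 + northward ξ u ^ 2))
      + 2 * ((eastward v u + radial ξ u * eastward ξ u - 2 * σ * northward ξ u) ^ 2
        + (northward v u + radial ξ u * northward ξ u + 2 * σ * eastward ξ u) ^ 2)
      - 4 * σ ^ 2 * (eastward ξ u ^ 2 + northward ξ u ^ 2) := by
  have hdet : (kinMetric D σ μ ξ v u).det ≠ 0 := by
    rw [det_kinMetric hu]
    exact mul_ne_zero hQ (pow_ne_zero 2 hc)
  have hI : ((kinMetric D σ μ ξ v u)⁻¹).IsSymm := kinMetric_isSymm.inv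
  rw [scalarCurvature_eq (fun w i j => hasFDerivAt_kinMetric D σ μ ξ v w i j)
    (fun k i j => hasFDerivAt_kinMetricDeriv σ μ ξ v u hu k i j) hdet
    kinMetricDeriv_isSymm kinMetric_isSymm,
    sum_mul_mul_of_antisymm hI (curvatureTensor_swap_left _ _ _)
      (curvatureTensor_swap_right hI kinMetricDerivTwo_comm kinMetricDerivTwo_isSymm),
    inv_kinMetric hu hQ hc]
  have hE : D + 2 * radial v u = lapseSq D ξ v u + eastward ξ u ^ 2 + northward ξ u ^ 2 := by
    simp only [lapseSq]; ring
  have hcs := Real.sin_sq_add_cos_sq (u 2)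
  obtain ⟨e₁, e₂, e₃, e₄, e₅, e₆, e₇, e₈, e₉⟩ :=
    curvatureTensor_kinMetric (D := D) (σ := σ) (μ := μ) (ξ := ξ) (v := v) hu hc
  rw [e₁, e₂, e₃, e₄, e₅, e₆, e₇, e₈, e₉]
  simp [kinMetricInv]
  generalize lapseSq D ξ v u = Q at *
  generalize Real.cos (u 2) = c at *
  field_simp
  ring

end value

/-! ### The first fundamental form of the first-order surface -/

/-- The point of the unit sphere with longitude `u 1` and latitude `u 2`. -/
def radialVec (u : Fin 3 → ℝ) : Fin 3 → ℝ :=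
  ![Real.cos (u 1) * Real.cos (u 2), Real.sin (u 1) * Real.cos (u 2), Real.sin (u 2)]

/-- The unit tangent vector pointing east. -/
def eastVec (u : Fin 3 → ℝ) : Fin 3 → ℝ := ![-Real.sin (u 1), Real.cos (u 1), 0]

/-- The unit tangent vector pointing north. -/
def northVec (u : Fin 3 → ℝ) : Fin 3 → ℝ :=
  ![-(Real.cos (u 1) * Real.sin (u 2)), -(Real.sin (u 1) * Real.sin (u 2)), Real.cos (u 2)]

lemma radial_eq (a u : Fin 3 → ℝ) : radial a u = a ⬝ᵥ radialVec u := by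
  simp [radial, radialVec, dotProduct, Fin.sum_univ_three]

lemma eastward_eq (a u : Fin 3 → ℝ) : eastward a u = a ⬝ᵥ eastVec u := by
  simp [eastward, eastVec, dotProduct, Fin.sum_univ_three]

lemma northward_eq (a u : Fin 3 → ℝ) : northward a u = a ⬝ᵥ northVec u := by
  simp [northward, northVec, dotProduct, Fin.sum_univ_three]
  ring

namespace EquiformMotion

variable (m : EquiformMotion)

lemma hasDerivAt_A (i j : Fin 7) : HasDerivAt (fun t => m.A t i j) (m.Ω i j) 0 := by
  have h : DifferentiableAt ℝ (fun t => m.A t i j) 0 :=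
    ((m.contDiffOn_A i j).differentiableOn one_ne_zero).differentiableAt
      (m.isOpen_I.mem_nhds m.zero_mem_I)
  exact h.hasDerivAt

/-- Differentiate `Aᵀ A = 1` at time zero. -/
lemma Ω_skew (hA : m.A 0 = 1) (i j : Fin 7) : m.Ω i j = -m.Ω j i := by
  have h1 : HasDerivAt (fun t => ∑ k, m.A t k i * m.A t k j)
      (∑ k, (m.Ω k i * m.A 0 k j + m.A 0 k i * m.Ω k j)) 0 :=
    HasDerivAt.fun_sum fun k _ => (m.hasDerivAt_A k i).mul (m.hasDerivAt_A k j)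
  have h2 : (fun t => ∑ k, m.A t k i * m.A t k j) =ᶠ[nhds 0]
      fun _ => (1 : Matrix (Fin 7) (Fin 7) ℝ) i j := by
    filter_upwards [m.isOpen_I.mem_nhds m.zero_mem_I] with t ht
    have := (Matrix.mem_orthogonalGroup_iff' (Fin 7) ℝ).mp
      (Matrix.mem_specialOrthogonalGroup_iff.mp (m.A_mem t ht)).1
    rw [← this]
    simp [Matrix.mul_apply]
  have h3 := (h1.congr_of_eventuallyEq h2.symm).unique (hasDerivAt_const 0 _)
  simp [hA, Finset.sum_add_distrib, Matrix.one_apply] at h3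
  linarith

/-- The first three entries of the `k`-th row of the identity matrix. -/
def baseRow (k : Fin 7) : Fin 3 → ℝ :=
  ![(1 : Matrix (Fin 7) (Fin 7) ℝ) k 0, (1 : Matrix (Fin 7) (Fin 7) ℝ) k 1,
    (1 : Matrix (Fin 7) (Fin 7) ℝ) k 2]

/-- The first three entries of the `k`-th row of `s' I + Ω`. -/
def velocityRow (k : Fin 7) : Fin 3 → ℝ := m.s' • baseRow k + ![m.Ω k 0, m.Ω k 1, m.Ω k 2]

/-- The vector `ξ` with `Ω x = ξ × x` modulo the last four coordinates, for `x` in the space of the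
first three coordinates. -/
def spin : Fin 3 → ℝ := ![-m.ω 7, m.ω 2, -m.ω 1]

/-- The vector `v` with `⟨v, x⟩ = ⟨d', Ω x⟩` for `x` in the space of the first three coordinates. -/
def drift : Fin 3 → ℝ := ![∑ k, m.b' k * m.Ω k 0, ∑ k, m.b' k * m.Ω k 1, ∑ k, m.b' k * m.Ω k 2]

/-- The squared length of the first column of `Ω`; under the sphere conditions the second and the
third column have the same length. -/
def columnSq : ℝ := ∑ i ∈ Finset.Icc 1 6, m.ω i ^ 2

/-- The squared length of the translational velocity. -/
def translationSq : ℝ := ∑ k, m.b' k ^ 2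

lemma firstOrderSurface_apply (h0 : m.NormalizedAtZero) (u : Fin 3 → ℝ) (k : Fin 7) :
    m.firstOrderSurface u k =
      radial (baseRow k) u + u 0 * (radial (m.velocityRow k) u + m.b' k) := by
  obtain ⟨hA, hs, hd⟩ := h0
  simp [firstOrderSurface, hA, hs, hd, Matrix.mulVec, dotProduct, Fin.sum_univ_seven, radial,
    velocityRow, sphereParam, b', baseRow]
  ring

/-- The `k`-th coordinate of the `i`-th partial derivative of the first-order surface. -/
def velocity (u : Fin 3 → ℝ) (k : Fin 7) (i : Fin 3) : ℝ :=
  match i with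
  | 0 => radial (m.velocityRow k) u + m.b' k
  | 1 => Real.cos (u 2) * (eastward (baseRow k) u + u 0 * eastward (m.velocityRow k) u)
  | 2 => northward (baseRow k) u + u 0 * northward (m.velocityRow k) u

lemma hasFDerivAt_firstOrderSurface_apply (h0 : m.NormalizedAtZero) (u : Fin 3 → ℝ) (k : Fin 7) :
    HasFDerivAt (fun w => m.firstOrderSurface w k) (ofPartials (m.velocity u k)) u := by
  have h := (hasFDerivAt_radial (baseRow k) u).fun_add ((hasFDerivAt_coord u 0).fun_mul
    ((hasFDerivAt_radial (m.velocityRow k) u).add_const (m.b' k)))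
  refine hasFDerivAt_ofPartials h (fun w => m.firstOrderSurface_apply h0 w k) ?_ ?_ ?_ <;>
    simp [ofPartials_single, velocity]
  ring

lemma partialDeriv_firstOrderSurface (h0 : m.NormalizedAtZero) (u : Fin 3 → ℝ) (k : Fin 7)
    (i : Fin 3) : partialDeriv i m.firstOrderSurface u k = m.velocity u k i := by
  have hX : HasFDerivAt m.firstOrderSurface
      ((PiLp.continuousLinearEquiv 2 ℝ (fun _ : Fin 7 => ℝ)).symm.toContinuousLinearMap.comp
        (ContinuousLinearMap.pi fun k => ofPartials (m.velocity u k))) u := by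
    rw [← hasFDerivWithinAt_univ, hasFDerivWithinAt_euclidean]
    intro k
    refine (m.hasFDerivAt_firstOrderSurface_apply h0 u k).hasFDerivWithinAt.congr_fderiv ?_
    ext x
    simp
  rw [partialDeriv, hX.fderiv]
  simp [ofPartials_single]

lemma firstFundamentalForm_apply (h0 : m.NormalizedAtZero) (u : Fin 3 → ℝ) (i j : Fin 3) :
    firstFundamentalForm m.firstOrderSurface u i j = ∑ k, m.velocity u k i * m.velocity u k j := by
  simp only [firstFundamentalForm, Matrix.of_apply, PiLp.inner_apply,
    m.partialDeriv_firstOrderSurface h0]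
  exact Finset.sum_congr rfl fun k _ => by simp [mul_comm]

lemma sum_baseRow_mul_baseRow (y z : Fin 3 → ℝ) :
    ∑ k, (baseRow k ⬝ᵥ y) * (baseRow k ⬝ᵥ z) = y ⬝ᵥ z := by
  simp [Fin.sum_univ_seven, baseRow, dotProduct, Fin.sum_univ_three]

lemma sum_baseRow_mul_velocityRow (hA : m.A 0 = 1) (y z : Fin 3 → ℝ) :
    ∑ k, (baseRow k ⬝ᵥ y) * (m.velocityRow k ⬝ᵥ z)
      = m.s' * (y ⬝ᵥ z) + m.spin ⬝ᵥ (crossProduct z y) := by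
  have h := m.Ω_skew hA
  have d : ∀ i, m.Ω i i = 0 := fun i => by linarith [h i i]
  simp [Fin.sum_univ_seven, baseRow, velocityRow, dotProduct, Fin.sum_univ_three, spin, ω,
    cross_apply, d, h 1 0, h 2 0, h 2 1]
  ring

/-- The sphere conditions: the first three columns of `s' I + Ω` are orthogonal and of equal
length. -/
lemma sum_velocityRow_mul_velocityRow (hA : m.A 0 = 1) (hs : m.SphereConditions)
    (y z : Fin 3 → ℝ) :
    ∑ k, (m.velocityRow k ⬝ᵥ y) * (m.velocityRow k ⬝ᵥ z)
      = (m.s' ^ 2 + m.columnSq) * (y ⬝ᵥ z) := by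
  have h := m.Ω_skew hA
  have d : ∀ i, m.Ω i i = 0 := fun i => by linarith [h i i]
  obtain ⟨h01, h02, h12, h1, h2⟩ := hs
  have i26 : Finset.Icc 2 6 = {2, 3, 4, 5, 6} := rfl
  have i36 : Finset.Icc 3 6 = {3, 4, 5, 6} := rfl
  have i16 : Finset.Icc 1 6 = {1, 2, 3, 4, 5, 6} := rfl
  have i811 : Finset.Icc 8 11 = {8, 9, 10, 11} := rfl
  have i711 : Finset.Icc 7 11 = {7, 8, 9, 10, 11} := rfl
  have i1215 : Finset.Icc 12 15 = {12, 13, 14, 15} := rfl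
  simp [i26, i36, i811, i711, i1215, ω] at h01 h02 h12 h1 h2
  simp [Fin.sum_univ_seven, baseRow, velocityRow, dotProduct, Fin.sum_univ_three, columnSq, i16, ω,
    d, h 1 0, h 2 0, h 2 1, h 3 0, h 3 1, h 3 2, h 4 0, h 4 1, h 4 2, h 5 0, h 5 1, h 5 2, h 6 0,
    h 6 1, h 6 2]
  linear_combination (y 0 * z 1 + y 1 * z 0) * h01 - (y 0 * z 2 + y 2 * z 0) * h02
    + (y 1 * z 2 + y 2 * z 1) * h12 - y 1 * z 1 * h1 - y 2 * z 2 * h2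

lemma sum_b'_mul_baseRow (hb : m.b' 0 = 0 ∧ m.b' 1 = 0 ∧ m.b' 2 = 0) (y : Fin 3 → ℝ) :
    ∑ k, m.b' k * (baseRow k ⬝ᵥ y) = 0 := by
  obtain ⟨h0, h1, h2⟩ := hb
  simp [Fin.sum_univ_seven, baseRow, dotProduct, Fin.sum_univ_three, h0, h1, h2]

lemma sum_b'_mul_velocityRow (hb : m.b' 0 = 0 ∧ m.b' 1 = 0 ∧ m.b' 2 = 0) (y : Fin 3 → ℝ) :
    ∑ k, m.b' k * (m.velocityRow k ⬝ᵥ y) = m.drift ⬝ᵥ y := by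
  have h : ∀ k, m.b' k * (m.velocityRow k ⬝ᵥ y) = m.s' * (m.b' k * (baseRow k ⬝ᵥ y))
      + m.b' k * (![m.Ω k 0, m.Ω k 1, m.Ω k 2] ⬝ᵥ y) := by
    intro k
    rw [velocityRow, add_dotProduct, smul_dotProduct, smul_eq_mul]
    ring
  simp only [h, Finset.sum_add_distrib, ← Finset.mul_sum, m.sum_b'_mul_baseRow hb]
  simp [dotProduct, Fin.sum_univ_three, drift, Finset.sum_mul, mul_add, Finset.sum_add_distrib,
    mul_assoc]

theorem firstFundamentalForm_firstOrderSurface (h0 : m.NormalizedAtZero)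
    (hsphere : m.SphereConditions) (hb : m.b' 0 = 0 ∧ m.b' 1 = 0 ∧ m.b' 2 = 0) :
    firstFundamentalForm m.firstOrderSurface =
      kinMetric (m.s' ^ 2 + m.columnSq + m.translationSq) m.s' (m.s' ^ 2 + m.columnSq)
        m.spin m.drift := by
  funext u
  have II := sum_baseRow_mul_baseRow
  have IM := m.sum_baseRow_mul_velocityRow h0.1
  have MM := m.sum_velocityRow_mul_velocityRow h0.1 hsphere
  have bI := m.sum_b'_mul_baseRow hb
  have bM := m.sum_b'_mul_velocityRow hb
  have bb : ∑ k, m.b' k ^ 2 = m.translationSq := rfl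
  set N := radialVec u with hN
  set E := eastVec u with hE
  set P := northVec u with hP
  have hcs := Real.sin_sq_add_cos_sq (u 2)
  have hCS := Real.sin_sq_add_cos_sq (u 1)
  have NN : N ⬝ᵥ N = 1 := by
    simp [hN, radialVec, dotProduct, Fin.sum_univ_three]
    linear_combination Real.cos (u 2) ^ 2 * hCS + hcs
  have EE : E ⬝ᵥ E = 1 := by
    simp [hE, eastVec, dotProduct, Fin.sum_univ_three]
    linear_combination hCS
  have PP : P ⬝ᵥ P = 1 := by
    simp [hP, northVec, dotProduct, Fin.sum_univ_three]
    linear_combination Real.sin (u 2) ^ 2 * hCS + hcs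
  have EN : E ⬝ᵥ N = 0 := by
    simp [hN, hE, radialVec, eastVec, dotProduct, Fin.sum_univ_three]
    ring
  have PN : P ⬝ᵥ N = 0 := by
    simp [hN, hP, radialVec, northVec, dotProduct, Fin.sum_univ_three]
    linear_combination -Real.cos (u 2) * Real.sin (u 2) * hCS
  have EP : E ⬝ᵥ P = 0 := by
    simp [hP, hE, northVec, eastVec, dotProduct, Fin.sum_univ_three]
    ring
  have cNE : crossProduct N E = P := by
    rw [hN, hE, hP, cross_apply]
    ext i
    fin_cases i <;> simp [radialVec, eastVec, northVec]
    · ring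
    · ring
    · linear_combination Real.cos (u 2) * hCS
  have cNP : crossProduct N P = -E := by
    rw [hN, hE, hP, cross_apply]
    ext i
    fin_cases i <;> simp [radialVec, eastVec, northVec]
    · linear_combination Real.sin (u 1) * hcs
    · linear_combination -Real.cos (u 1) * hcs
    · ring
  ext i j
  rw [m.firstFundamentalForm_apply h0]
  have h00 : ∑ k, m.velocity u k 0 * m.velocity u k 0
      = m.s' ^ 2 + m.columnSq + m.translationSq + 2 * radial m.drift u := by
    have h1 := MM N N
    have h2 := bM N
    rw [NN] at h1
    simp only [velocity, radial_eq, ← hN, Fin.sum_univ_seven] at h1 h2 bb ⊢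
    linear_combination h1 + 2 * h2 + bb
  have h01 : ∑ k, m.velocity u k 0 * m.velocity u k 1
      = Real.cos (u 2) * northward m.spin u + u 0 * (Real.cos (u 2) * eastward m.drift u) := by
    have h1 := IM E N
    have h2 := MM E N
    have h3 := bI E
    have h4 := bM E
    rw [EN] at h1 h2
    rw [cNE] at h1
    simp only [velocity, radial_eq, eastward_eq, northward_eq, ← hN, ← hE, ← hP,
      Fin.sum_univ_seven] at h1 h2 h3 h4 ⊢
    linear_combination Real.cos (u 2) * (h1 + u 0 * h2 + h3 + u 0 * h4)
  have h02 : ∑ k, m.velocity u k 0 * m.velocity u k 2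
      = -eastward m.spin u + u 0 * northward m.drift u := by
    have h1 := IM P N
    have h2 := MM P N
    have h3 := bI P
    have h4 := bM P
    rw [PN] at h1 h2
    rw [cNP, dotProduct_neg] at h1
    simp only [velocity, radial_eq, eastward_eq, northward_eq, ← hN, ← hE, ← hP,
      Fin.sum_univ_seven] at h1 h2 h3 h4 ⊢
    linear_combination h1 + u 0 * h2 + h3 + u 0 * h4
  have h11 : ∑ k, m.velocity u k 1 * m.velocity u k 1
      = (1 + 2 * m.s' * u 0 + (m.s' ^ 2 + m.columnSq) * (u 0 * u 0))
        * (Real.cos (u 2) * Real.cos (u 2)) := by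
    have h1 := II E E
    have h2 := IM E E
    have h3 := MM E E
    rw [cross_self, dotProduct_zero] at h2
    rw [EE] at h1 h2 h3
    simp only [velocity, eastward_eq, ← hE, Fin.sum_univ_seven] at h1 h2 h3 ⊢
    linear_combination Real.cos (u 2) ^ 2 * (h1 + 2 * u 0 * h2 + u 0 ^ 2 * h3)
  have h12 : ∑ k, m.velocity u k 1 * m.velocity u k 2 = 0 := by
    have h1 := II E P
    have h2 := IM E P
    have h3 := IM P E
    have h4 := MM E P
    rw [dotProduct_comm P E] at h3
    rw [← cross_anticomm, dotProduct_neg] at h2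
    rw [EP] at h1 h2 h3 h4
    simp only [velocity, eastward_eq, northward_eq, ← hE, ← hP,
      Fin.sum_univ_seven] at h1 h2 h3 h4 ⊢
    linear_combination Real.cos (u 2) * (h1 + u 0 * h2 + u 0 * h3 + u 0 ^ 2 * h4)
  have h22 : ∑ k, m.velocity u k 2 * m.velocity u k 2
      = 1 + 2 * m.s' * u 0 + (m.s' ^ 2 + m.columnSq) * (u 0 * u 0) := by
    have h1 := II P P
    have h2 := IM P P
    have h3 := MM P P
    rw [cross_self, dotProduct_zero] at h2
    rw [PP] at h1 h2 h3
    simp only [velocity, northward_eq, ← hP, Fin.sum_univ_seven] at h1 h2 h3 ⊢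
    linear_combination h1 + 2 * u 0 * h2 + u 0 ^ 2 * h3
  have comm : ∀ i j, ∑ k, m.velocity u k i * m.velocity u k j
      = ∑ k, m.velocity u k j * m.velocity u k i :=
    fun i j => Finset.sum_congr rfl fun k _ => mul_comm _ _
  match i, j with
  | 0, 0 => simp [kinMetric, h00]
  | 0, 1 => simp [kinMetric, h01]
  | 1, 0 => simp [kinMetric, comm 1 0, h01]
  | 0, 2 => simp [kinMetric, h02]
  | 2, 0 => simp [kinMetric, comm 2 0, h02]
  | 1, 1 => simp [kinMetric, h11]
  | 1, 2 => simp [kinMetric, h12]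
  | 2, 1 => simp [kinMetric, comm 2 1, h12]
  | 2, 2 => simp [kinMetric, h22]

end EquiformMotion

/-! ### Curvature as a polynomial identity on the sphere -/

/-- The squared lapse `N²` as a function of a point `x` of the unit sphere. -/
def lapsePoly (C : ℝ) (ξ v x : Fin 3 → ℝ) : ℝ := C + 2 * (v ⬝ᵥ x) + (ξ ⬝ᵥ x) ^ 2

/-- The polynomial `κ N⁴ - (R - 2) N⁴`, where `R` is the scalar curvature of `kinMetric` at time
zero at the point `x` of the unit sphere. Here `C = D - |ξ|²` and `B = 2 σ² - 4 μ - 2 |ξ|²`. -/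
def curvaturePoly (κ C B σ : ℝ) (ξ v x : Fin 3 → ℝ) : ℝ :=
  κ * lapsePoly C ξ v x ^ 2 - (lapsePoly C ξ v x * (B + 6 * (ξ ⬝ᵥ x) ^ 2)
    + 4 * σ ^ 2 * (ξ ⬝ᵥ ξ - (ξ ⬝ᵥ x) ^ 2) - 8 * σ * (v ⬝ᵥ crossProduct ξ x)
    + 2 * (v ⬝ᵥ v - (v ⬝ᵥ x) ^ 2 + 2 * (ξ ⬝ᵥ x) * (v ⬝ᵥ ξ) - 2 * (v ⬝ᵥ x) * (ξ ⬝ᵥ x) ^ 2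
      + (ξ ⬝ᵥ x) ^ 2 * (ξ ⬝ᵥ ξ - (ξ ⬝ᵥ x) ^ 2)))

lemma dotProduct_self_pos {e : Fin 3 → ℝ} (he : e ≠ 0) : 0 < e ⬝ᵥ e := by
  refine lt_of_le_of_ne (Finset.sum_nonneg fun i _ => mul_self_nonneg _) fun h => he ?_
  exact dotProduct_self_eq_zero.mp h.symm

lemma coeffs_eq_zero_of_three_roots {c₀ c₁ c₂ x y z : ℝ} (hxy : x ≠ y) (hxz : x ≠ z) (hyz : y ≠ z)
    (hx : c₀ + c₁ * x + c₂ * x ^ 2 = 0) (hy : c₀ + c₁ * y + c₂ * y ^ 2 = 0)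
    (hz : c₀ + c₁ * z + c₂ * z ^ 2 = 0) : c₀ = 0 ∧ c₁ = 0 ∧ c₂ = 0 := by
  have h1 : c₁ + c₂ * (x + y) = 0 :=
    (mul_eq_zero.mp (by linear_combination hx - hy :
      (x - y) * (c₁ + c₂ * (x + y)) = 0)).resolve_left (sub_ne_zero.mpr hxy)
  have h2 : c₁ + c₂ * (x + z) = 0 :=
    (mul_eq_zero.mp (by linear_combination hx - hz :
      (x - z) * (c₁ + c₂ * (x + z)) = 0)).resolve_left (sub_ne_zero.mpr hxz)
  have h3 : c₂ = 0 :=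
    (mul_eq_zero.mp (by linear_combination h1 - h2 : (y - z) * c₂ = 0)).resolve_left
      (sub_ne_zero.mpr hyz)
  have h4 : c₁ = 0 := by rw [h3] at h1; linarith
  rw [h3, h4] at hx
  exact ⟨by linarith, h4, h3⟩

section

variable {κ C B σ : ℝ} {ξ v : Fin 3 → ℝ}

/-- The even and the odd part of the identity, made homogeneous of degree four and three. -/
lemma curvaturePoly_parts (h : ∀ x, x ⬝ᵥ x = 1 → curvaturePoly κ C B σ ξ v x = 0)
    {y : Fin 3 → ℝ} (hy : y ≠ 0) :
    κ * ((C * (y ⬝ᵥ y) + (ξ ⬝ᵥ y) ^ 2) ^ 2 + 4 * (v ⬝ᵥ y) ^ 2 * (y ⬝ᵥ y)) =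
        (C * (y ⬝ᵥ y) + (ξ ⬝ᵥ y) ^ 2) * (B * (y ⬝ᵥ y) + 6 * (ξ ⬝ᵥ y) ^ 2)
        + 4 * σ ^ 2 * ((ξ ⬝ᵥ ξ) * (y ⬝ᵥ y) - (ξ ⬝ᵥ y) ^ 2) * (y ⬝ᵥ y)
        + 2 * ((v ⬝ᵥ v) * (y ⬝ᵥ y) ^ 2 - (v ⬝ᵥ y) ^ 2 * (y ⬝ᵥ y)
          + (ξ ⬝ᵥ y) ^ 2 * ((ξ ⬝ᵥ ξ) * (y ⬝ᵥ y) - (ξ ⬝ᵥ y) ^ 2)) ∧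
      2 * κ * (v ⬝ᵥ y) * (C * (y ⬝ᵥ y) + (ξ ⬝ᵥ y) ^ 2) =
        (v ⬝ᵥ y) * (B * (y ⬝ᵥ y) + 6 * (ξ ⬝ᵥ y) ^ 2)
        - 4 * σ * (v ⬝ᵥ crossProduct ξ y) * (y ⬝ᵥ y)
        + 2 * (ξ ⬝ᵥ y) * (v ⬝ᵥ ξ) * (y ⬝ᵥ y) - 2 * (v ⬝ᵥ y) * (ξ ⬝ᵥ y) ^ 2 := by
  have hn := dotProduct_self_pos hy
  obtain ⟨L, hL, hLn⟩ : ∃ L : ℝ, L ≠ 0 ∧ L ^ 2 * (y ⬝ᵥ y) = 1 := by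
    refine ⟨(Real.sqrt (y ⬝ᵥ y))⁻¹, (inv_pos.mpr (Real.sqrt_pos.mpr hn)).ne', ?_⟩
    rw [inv_pow, Real.sq_sqrt hn.le, inv_mul_cancel₀ hn.ne']
  have h1 := h (L • y) (by simp; linear_combination hLn)
  have h2 := h (-(L • y)) (by simp; linear_combination hLn)
  simp only [curvaturePoly, lapsePoly, dotProduct_neg, dotProduct_smul, smul_eq_mul, map_neg,
    map_smul] at h1 h2
  generalize y ⬝ᵥ y = n at *
  generalize ξ ⬝ᵥ y = p at *
  generalize v ⬝ᵥ y = f at *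
  generalize v ⬝ᵥ crossProduct ξ y = τ at *
  generalize ξ ⬝ᵥ ξ = a at *
  generalize v ⬝ᵥ v = V at *
  generalize v ⬝ᵥ ξ = m at *
  have hC : n = (L ^ 2)⁻¹ := eq_inv_of_mul_eq_one_right hLn
  constructor
  · have e := congrArg₂ (· + ·) h1 h2
    subst hC
    field_simp
    linear_combination e / 2
  · have e : L * (2 * κ * f * (C  + L ^ 2 * p ^ 2) - (f * (B + 6 * L ^ 2 * p ^ 2) - 4 * σ * τ
        + 2 * p * m - 2 * f * L ^ 2 * p ^ 2)) = 0 := by linear_combination (h1 - h2) / 4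
    have e' := (mul_eq_zero.mp e).resolve_left hL
    subst hC
    field_simp
    linear_combination e'

/-- If `ξ ≠ 0` the leading terms force `κ = 4`, the odd part forces `v = 0`, and the quadratic terms
in `⟨ξ, x⟩` leave one relation between the constants. -/
lemma drift_eq_zero_of_spin_ne_zero (h : ∀ x, x ⬝ᵥ x = 1 → curvaturePoly κ C B σ ξ v x = 0)
    (hξ : ξ ≠ 0) : v = 0 ∧ 2 * C = B - 4 * σ ^ 2 + 2 * (ξ ⬝ᵥ ξ) := by
  have ha := dotProduct_self_pos hξ
  -- On the line `ξ + β e` the function `⟨ξ, x⟩` is constant.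
  have line : ∀ e, e ≠ 0 → ξ ⬝ᵥ e = 0 → ∀ β : ℝ,
      (ξ + β • e) ≠ 0 ∧ (ξ + β • e) ⬝ᵥ (ξ + β • e) = ξ ⬝ᵥ ξ + β ^ 2 * (e ⬝ᵥ e) ∧
      ξ ⬝ᵥ (ξ + β • e) = ξ ⬝ᵥ ξ ∧ v ⬝ᵥ (ξ + β • e) = v ⬝ᵥ ξ + β * (v ⬝ᵥ e) ∧
      v ⬝ᵥ crossProduct ξ (ξ + β • e) = β * (v ⬝ᵥ crossProduct ξ e) := by
    intro e _ hξe β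
    have hp : ξ ⬝ᵥ (ξ + β • e) = ξ ⬝ᵥ ξ := by simp [hξe]
    refine ⟨fun h0 => ?_, ?_, hp, by simp, by simp [cross_self]⟩
    · rw [h0, dotProduct_zero] at hp
      exact ha.ne hp
    · have := dotProduct_comm e ξ
      simp [hξe, this]
      ring
  have key : ∀ e, e ≠ 0 → ξ ⬝ᵥ e = 0 → v ⬝ᵥ ξ = 0 ∧ v ⬝ᵥ e = 0 ∧ κ = 4 ∧
      2 * κ * C - (B + 6 * C) + 4 * σ ^ 2 - 2 * (ξ ⬝ᵥ ξ) = 0 := by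
    intro e he hξe
    have hε := dotProduct_self_pos he
    have ev : ∀ β : ℝ, _ := fun β => curvaturePoly_parts h (line e he hξe β).1
    simp only [(line e he hξe _).2.1, (line e he hξe _).2.2.1, (line e he hξe _).2.2.2.1,
      (line e he hξe _).2.2.2.2] at ev
    generalize e ⬝ᵥ e = ε at *
    generalize ξ ⬝ᵥ ξ = a at *
    generalize v ⬝ᵥ ξ = m at *
    generalize v ⬝ᵥ e = w at *
    generalize v ⬝ᵥ crossProduct ξ e = ρ at *
    generalize v ⬝ᵥ v = V at *
    -- Averaged over `± β`, the even part is a quadratic polynomial in `|ξ + β e|² = a + β² ε`.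
    have hx : a ≠ a + ε := by linarith
    have hxz : a ≠ a + 4 * ε := by linarith
    have hyz : a + ε ≠ a + 4 * ε := by linarith
    obtain ⟨c0, c1, -⟩ := coeffs_eq_zero_of_three_roots (c₀ := ε * (κ - 4) * a ^ 4)
      (c₁ := ε * (2 * κ * C * a ^ 2 + (4 * κ + 2) * m ^ 2 - (B + 6 * C) * a ^ 2
        + 4 * σ ^ 2 * a ^ 2 - 2 * a ^ 3) - (4 * κ + 2) * a * w ^ 2)
      (c₂ := ε * (κ * C ^ 2 - C * B - 4 * σ ^ 2 * a - 2 * V) + (4 * κ + 2) * w ^ 2) hx hxz hyz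
      (by linear_combination ε * (ev 0).1)
      (by linear_combination ε / 2 * ((ev 1).1 + (ev (-1)).1))
      (by linear_combination ε / 2 * ((ev 2).1 + (ev (-2)).1))
    have hκ : κ = 4 := by
      have : ε * a ^ 4 ≠ 0 := by positivity
      have h4 : ε * a ^ 4 * (κ - 4) = 0 := by linear_combination c0
      linarith [(mul_eq_zero.mp h4).resolve_left this]
    subst hκ
    -- The values of the odd part at two distances from the origin isolate its constant term: the
    -- part even in `β` gives `m = 0`, the part odd in `β` gives `w = 0`.
    have hm : m = 0 := by
      have : ε * a ^ 2 ≠ 0 := by positivity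
      have h0 : ε * a ^ 2 * m = 0 := by
        linear_combination (a + ε) / 4 * (ev 0).2 - a / 8 * ((ev 1).2 + (ev (-1)).2)
      exact (mul_eq_zero.mp h0).resolve_left this
    have hw : w = 0 := by
      have : ε * a ^ 2 ≠ 0 := by positivity
      have h0 : ε * a ^ 2 * w = 0 := by
        linear_combination (a + 4 * ε) / 24 * ((ev 1).2 - (ev (-1)).2)
          - (a + ε) / 48 * ((ev 2).2 - (ev (-2)).2)
      exact (mul_eq_zero.mp h0).resolve_left this
    refine ⟨hm, hw, rfl, ?_⟩
    subst hm hw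
    have : ε * a ^ 2 ≠ 0 := by positivity
    exact (mul_eq_zero.mp (by linear_combination c1 : ε * a ^ 2 * _ = 0)).resolve_left this
  obtain ⟨e, he, heξ⟩ := exists_ne_zero_dotProduct_eq_zero ξ
  obtain ⟨hm, -, hκ, hlin⟩ := key e he (by rw [dotProduct_comm, heξ])
  refine ⟨?_, by subst hκ; linarith⟩
  -- Now `v ⊥ ξ`, so that `e = v` is an admissible direction.
  by_contra hv
  have := (key v hv (by rw [dotProduct_comm, hm])).2.1
  exact (dotProduct_self_pos hv).ne' this

/-- If `ξ = 0` and `v ≠ 0`, compare the points in the direction of `v` with those orthogonal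
to it. -/
lemma curvature_of_spin_eq_zero (h : ∀ x, x ⬝ᵥ x = 1 → curvaturePoly κ C B σ 0 v x = 0)
    (hC : C ≠ 0) : κ = -1 / 2 ∨ κ * C = B := by
  by_cases hv : v = 0
  · right
    have := h ![1, 0, 0] (by simp [dotProduct, Fin.sum_univ_three])
    simp [curvaturePoly, lapsePoly, hv] at this
    exact mul_left_cancel₀ hC (by linear_combination this)
  · left
    have hV := dotProduct_self_pos hv
    obtain ⟨e, he, hev⟩ := exists_ne_zero_dotProduct_eq_zero v
    have hve : v ⬝ᵥ e = 0 := by rw [dotProduct_comm, hev]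
    have hε := dotProduct_self_pos he
    have h1 := (curvaturePoly_parts h hv).1
    have h2 := (curvaturePoly_parts h he).1
    simp [hve] at h1 h2
    generalize v ⬝ᵥ v = V at *
    generalize e ⬝ᵥ e = ε at *
    have h3 : V ^ 2 * (κ * (C ^ 2 + 4 * V) - C * B) = 0 := by linear_combination h1
    have h4 : ε ^ 2 * (κ * C ^ 2 - C * B - 2 * V) = 0 := by linear_combination h2
    have h5 := (mul_eq_zero.mp h3).resolve_left (by positivity)
    have h6 := (mul_eq_zero.mp h4).resolve_left (by positivity)
    have h7 : V * (4 * κ + 2) = 0 := by linear_combination h5 - h6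
    linarith [(mul_eq_zero.mp h7).resolve_left hV.ne']

end

/-! ### From the parameters to the sphere -/

/-- Parseval's identity in the frame of the sphere. -/
lemma radial_mul_add (a b u : Fin 3 → ℝ) :
    radial a u * radial b u + eastward a u * eastward b u + northward a u * northward b u
      = a ⬝ᵥ b := by
  have hc := Real.sin_sq_add_cos_sq (u 2)
  have hC := Real.sin_sq_add_cos_sq (u 1)
  simp only [radial, eastward, northward, dotProduct, Fin.sum_univ_three]
  generalize Real.sin (u 1) = S at *
  generalize Real.cos (u 1) = T at *
  generalize Real.sin (u 2) = s at *
  generalize Real.cos (u 2) = c at *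
  grind

lemma eastward_mul_northward_sub (a b u : Fin 3 → ℝ) :
    eastward a u * northward b u - northward a u * eastward b u
      = a ⬝ᵥ crossProduct b (radialVec u) := by
  have hc := Real.sin_sq_add_cos_sq (u 2)
  have hC := Real.sin_sq_add_cos_sq (u 1)
  simp [eastward, northward, dotProduct, Fin.sum_univ_three, cross_apply, radialVec]
  generalize Real.sin (u 1) = S at *
  generalize Real.cos (u 1) = T at *
  generalize Real.sin (u 2) = s at *
  generalize Real.cos (u 2) = c at *
  grind

lemma lapseSq_eq_lapsePoly (D : ℝ) (ξ v u : Fin 3 → ℝ) :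
    lapseSq D ξ v u = lapsePoly (D - ξ ⬝ᵥ ξ) ξ v (radialVec u) := by
  have h := radial_mul_add ξ ξ u
  simp only [lapseSq, lapsePoly, ← radial_eq]
  linear_combination -h

lemma curvaturePoly_eq_zero {D σ μ K : ℝ} {ξ v u : Fin 3 → ℝ} (hu : u 0 = 0)
    (hQ : lapseSq D ξ v u ≠ 0) (hc : Real.cos (u 2) ≠ 0)
    (hK : scalarCurvature (kinMetric D σ μ ξ v) u = K) :
    curvaturePoly (K - 2) (D - ξ ⬝ᵥ ξ) (2 * σ ^ 2 - 4 * μ - 2 * (ξ ⬝ᵥ ξ)) σ ξ v (radialVec u)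
      = 0 := by
  have h := scalarCurvature_kinMetric (σ := σ) (μ := μ) hu hQ hc
  rw [hK, lapseSq_eq_lapsePoly] at h
  have hξξ := radial_mul_add ξ ξ u
  have hvv := radial_mul_add v v u
  have hvξ := radial_mul_add v ξ u
  have hx := eastward_mul_northward_sub v ξ u
  simp only [curvaturePoly, ← radial_eq, ← hx]
  linear_combination h - (2 * lapsePoly (D - ξ ⬝ᵥ ξ) ξ v (radialVec u) - 4 * σ ^ 2
    - 2 * radial ξ u ^ 2) * hξξ + 2 * hvv + 4 * radial ξ u * hvξ

lemma exists_radialVec_eq {x : Fin 3 → ℝ} (hx : x ⬝ᵥ x = 1) :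
    ∃ y : ℝ × ℝ, radialVec ![0, y.1, y.2] = x := by
  simp only [dotProduct, Fin.sum_univ_three] at hx
  set z : ℂ := ⟨x 0, x 1⟩ with hz
  have hn : ‖z‖ = Real.cos (Real.arcsin (x 2)) := by
    rw [Real.cos_arcsin, Complex.norm_def, Complex.normSq_apply]
    congr 1
    linarith
  have h2 : Real.sin (Real.arcsin (x 2)) = x 2 :=
    Real.sin_arcsin (by nlinarith [sq_nonneg (x 0), sq_nonneg (x 1)])
      (by nlinarith [sq_nonneg (x 0), sq_nonneg (x 1)])
  refine ⟨(Complex.arg z, Real.arcsin (x 2)), ?_⟩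
  ext i
  fin_cases i
  · have := Complex.norm_mul_cos_arg z
    simp [radialVec]
    rw [← hn, mul_comm, this]
  · have := Complex.norm_mul_sin_arg z
    simp [radialVec]
    rw [← hn, mul_comm, this]
  · simpa [radialVec] using h2

/-- The identity theorem for real analytic functions of the two angles: the lapse is nonzero on some
open subset of `U`, the identity holds there, hence everywhere. -/
lemma curvaturePoly_eq_zero_of_open {κ C B σ : ℝ} {ξ v : Fin 3 → ℝ} {U : Set (ℝ × ℝ)}
    (hU : IsOpen U) (hne : U.Nonempty)
    (h : ∀ y ∈ U, lapsePoly C ξ v (radialVec ![0, y.1, y.2]) ≠ 0 →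
      curvaturePoly κ C B σ ξ v (radialVec ![0, y.1, y.2]) = 0)
    (hQ : ∃ x, x ⬝ᵥ x = 1 ∧ lapsePoly C ξ v x ≠ 0) :
    ∀ x, x ⬝ᵥ x = 1 → curvaturePoly κ C B σ ξ v x = 0 := by
  set Q : ℝ × ℝ → ℝ := fun y => lapsePoly C ξ v (radialVec ![0, y.1, y.2]) with hQdef
  set T : ℝ × ℝ → ℝ := fun y => curvaturePoly κ C B σ ξ v (radialVec ![0, y.1, y.2]) with hTdef
  have aQ : AnalyticOnNhd ℝ Q Set.univ := by
    rw [← contDiff_omega_iff_analyticOnNhd]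
    simp [hQdef, lapsePoly, radialVec, dotProduct, Fin.sum_univ_three]
    fun_prop
  have aT : AnalyticOnNhd ℝ T Set.univ := by
    rw [← contDiff_omega_iff_analyticOnNhd]
    simp [hTdef, curvaturePoly, lapsePoly, radialVec, dotProduct, Fin.sum_univ_three, cross_apply]
    fun_prop
  obtain ⟨x₀, hx₀, hx₀'⟩ := hQ
  obtain ⟨y₀, rfl⟩ := exists_radialVec_eq hx₀
  have : ∃ y ∈ U, Q y ≠ 0 := by
    by_contra! hall
    obtain ⟨y, hy⟩ := hne
    refine hx₀' (aQ.eqOn_zero_of_preconnected_of_eventuallyEq_zero isPreconnected_univ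
      (Set.mem_univ y) ?_ (Set.mem_univ y₀))
    filter_upwards [hU.mem_nhds hy] with y' hy' using hall y' hy'
  obtain ⟨y, hy, hQy⟩ := this
  have hT := aT.eqOn_zero_of_preconnected_of_eventuallyEq_zero isPreconnected_univ
    (Set.mem_univ y) (by
      filter_upwards [hU.mem_nhds hy, (aQ y (Set.mem_univ y)).continuousAt.eventually_ne hQy]
        with y' hy' hQy' using h y' hy' hQy')
  intro x hx
  obtain ⟨y', rfl⟩ := exists_radialVec_eq hx
  exact hT (Set.mem_univ y')

/-- Sum the values of `N²` over the six points `± eᵢ`. -/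
lemma exists_lapsePoly_ne_zero {C : ℝ} {ξ : Fin 3 → ℝ} (v : Fin 3 → ℝ)
    (h : 3 * C + ξ ⬝ᵥ ξ ≠ 0) : ∃ x, x ⬝ᵥ x = 1 ∧ lapsePoly C ξ v x ≠ 0 := by
  by_contra! hall
  have e : ∀ i, C + ξ i ^ 2 = 0 := by
    intro i
    have h1 := hall (Pi.single i 1) (by simp)
    have h2 := hall (-Pi.single i 1) (by simp)
    simp [lapsePoly] at h1 h2
    linarith
  apply h
  simp only [dotProduct, Fin.sum_univ_three]
  linarith [e 0, e 1, e 2]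

/-! ### Size of the rotational velocity -/

namespace EquiformMotion

variable {m : EquiformMotion}

/-- Up to sign, the first three columns of `Ω` contain each of `ω₁, …, ω₁₅` once, and the components
`ω₁, ω₂, ω₇` of `ξ` a second time. -/
lemma three_mul_columnSq (hs : m.SphereConditions) :
    3 * m.columnSq = ∑ i ∈ Finset.Icc 1 15, m.ω i ^ 2 + m.spin ⬝ᵥ m.spin := by
  obtain ⟨-, -, -, h1, h2⟩ := hs
  have i26 : Finset.Icc 2 6 = {2, 3, 4, 5, 6} := rfl
  have i36 : Finset.Icc 3 6 = {3, 4, 5, 6} := rfl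
  have i16 : Finset.Icc 1 6 = {1, 2, 3, 4, 5, 6} := rfl
  have i115 : Finset.Icc 1 15 = {1, 2, 3, 4, 5, 6, 7, 8, 9, 10, 11, 12, 13, 14, 15} := rfl
  have i711 : Finset.Icc 7 11 = {7, 8, 9, 10, 11} := rfl
  have i1215 : Finset.Icc 12 15 = {12, 13, 14, 15} := rfl
  simp [i26, i36, i711, i1215] at h1 h2
  simp [columnSq, i16, i115, spin, dotProduct, Fin.sum_univ_three]
  linear_combination h1 + h2

lemma spin_dotProduct_self_le : m.spin ⬝ᵥ m.spin ≤ ∑ i ∈ Finset.Icc 1 15, m.ω i ^ 2 := by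
  have i115 : Finset.Icc 1 15 = {1, 2, 3, 4, 5, 6, 7, 8, 9, 10, 11, 12, 13, 14, 15} := rfl
  simp [i115, spin, dotProduct, Fin.sum_univ_three]
  have := fun i => sq_nonneg (m.ω i)
  linarith [this 3, this 4, this 5, this 6, this 8, this 9, this 10, this 11, this 12, this 13,
    this 14, this 15]

end EquiformMotion

end

theorem mainTheorem1 (m : EquiformMotion)
    (h0 : m.NormalizedAtZero)
    (hsphere : m.SphereConditions)
    (hb : m.b' 0 = 0 ∧ m.b' 1 = 0 ∧ m.b' 2 = 0)
    (hmotion : m.s' ≠ 0 ∨ ((∃ i, m.b' i ≠ 0) ∧ ∃ i ∈ Finset.Icc 1 15, m.ω i ≠ 0))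
    (K : ℝ)
    (hK : ∀ θ ∈ Set.Icc 0 (2 * Real.pi), ∀ φ ∈ Set.Icc 0 Real.pi,
      (firstFundamentalForm m.firstOrderSurface ![0, θ, φ]).det ≠ 0 →
        scalarCurvature (firstFundamentalForm m.firstOrderSurface) ![0, θ, φ] = K) :
    |K| < 2 := by
  rw [m.firstFundamentalForm_firstOrderSurface h0 hsphere hb] at hK
  have hsum := EquiformMotion.three_mul_columnSq hsphere
  have hle := m.spin_dotProduct_self_le
  have hspin : 0 ≤ m.spin ⬝ᵥ m.spin := Finset.sum_nonneg fun i _ => mul_self_nonneg _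
  have hβ : 0 ≤ m.translationSq := Finset.sum_nonneg fun i _ => sq_nonneg _
  have hσ := sq_nonneg m.s'
  have hpos : 0 < m.s' ^ 2 ∨ (0 < m.translationSq ∧ 0 < m.columnSq) := by
    refine hmotion.imp (fun h => by positivity) fun ⟨⟨i, hi⟩, j, hj, hj'⟩ => ⟨?_, ?_⟩
    · exact Finset.sum_pos' (fun i _ => sq_nonneg _) ⟨i, Finset.mem_univ i, by positivity⟩
    · have : 0 < ∑ i ∈ Finset.Icc 1 15, m.ω i ^ 2 :=
        Finset.sum_pos' (fun i _ => sq_nonneg _) ⟨j, hj, by positivity⟩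
      linarith
  have hpoly := curvaturePoly_eq_zero_of_open (κ := K - 2) (σ := m.s') (v := m.drift)
    (C := m.s' ^ 2 + m.columnSq + m.translationSq - m.spin ⬝ᵥ m.spin)
    (B := 2 * m.s' ^ 2 - 4 * (m.s' ^ 2 + m.columnSq) - 2 * (m.spin ⬝ᵥ m.spin)) (ξ := m.spin)
    -- On this open set of angles `cos φ > 0`, so only the lapse can make the metric degenerate.
    (isOpen_Ioo.prod isOpen_Ioo : IsOpen (Set.Ioo 0 (2 * Real.pi) ×ˢ Set.Ioo 0 (Real.pi / 2)))
    ⟨(1, 1), ⟨one_pos, by linarith [Real.pi_gt_three]⟩, one_pos, by linarith [Real.pi_gt_three]⟩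
    (by
      rintro ⟨θ, φ⟩ ⟨⟨hθ, hθ'⟩, hφ, hφ'⟩ hQ
      simp only at hθ hθ' hφ hφ' hQ ⊢
      rw [← lapseSq_eq_lapsePoly] at hQ
      have hc : Real.cos φ ≠ 0 := (Real.cos_pos_of_mem_Ioo ⟨by linarith, hφ'⟩).ne'
      refine curvaturePoly_eq_zero (by simp) hQ (by simpa using hc)
        (hK θ ⟨hθ.le, hθ'.le⟩ φ ⟨hφ.le, by linarith [Real.pi_pos]⟩ ?_)
      rw [det_kinMetric (by simp)]
      exact mul_ne_zero hQ (pow_ne_zero 2 (by simpa using hc)))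
    (exists_lapsePoly_ne_zero _ (by rcases hpos with h | h <;> linarith))
  by_cases hξ : m.spin = 0
  · rw [hξ] at hpoly
    simp only [zero_dotProduct, sub_zero, mul_zero] at hpoly
    have hD : 0 < m.s' ^ 2 + m.columnSq + m.translationSq := by
      rcases hpos with h | h <;> linarith
    rw [abs_lt]
    rcases curvature_of_spin_eq_zero hpoly hD.ne' with h | h
    · constructor <;> linarith
    · constructor
      · by_contra! hcon
        rcases hpos with h' | h' <;> nlinarith
      · by_contra! hcon
        rcases hpos with h' | h' <;> nlinarith
  · -- The relation between the velocities reads `8 s'² + 6 w² + 2 |d'|² = 2 |ξ|²`.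
    have h := (drift_eq_zero_of_spin_ne_zero hpoly hξ).2
    have := dotProduct_self_pos hξ
    linarith
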